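/- Theorem (algorithmic Lovász Local Lemma by polynomial evaluation). Let $\omega_1,\dots,\omega_m$ ($m\ge 1$) be independent $\{0,1\}$-valued variables and let $\mathcal E_1,\dots,\mathcal E_n\subseteq\{0,1\}^m$ ($n\ge1$) be events, where $\mathcal E_j$ is determined by the variables with index in $A_j\subseteq[m]$. Let $G$ be the dependency graph on $[n]$, in which distinct $j,k$ are adjacent iff $A_j\cap A_k\neq\emptyset$, and let $d$ be its maximum degree. For $z\in[0,1]^m$ let $\mu_z$ be the product distribution on $\{0,1\}^m$ with expectation $z$, and let $p(z)\in[0,1]^n$, $p_j(z)=\mu_z(\mathcal E_j)$. The Shearer region $\mathcal S_G$ is the set of all $p\in[0,1]^n$ such that $\sum_{I\subseteq S,\ I\text{ independent in }G}(-1)^{|I|}\prod_{v\in I}p_v>0$ for every $S\subseteq[n]$. Time is the number of steps of a deterministic program that performs exact arithmetic operations and comparisons of real numbers at unit cost. Fix $c\in\mathbb N$. Then there is a constant $C>0$, depending only on $c$, with the following property. Consider any format for describing the events, and suppose that one program computes, for all instances $(A_1,\dots,A_n;\mathcal E_1,\dots,\mathcal E_n)$ described in this format, the vector $p(z)$ from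 $A_1,\dots,A_n$, the description of the events and $z\in[0,1]^m$, in time at most $(n+m+1)^c$. Then there is a deterministic program that, given the sets $A_1,\dots,A_n$, the description of the events, a vector $z\in[0,1]^m$ and a number $\alpha\in(0,1]$ such that $(1+\alpha)\,p(z)\in\mathcal S_G$, outputs a point of $\bigcap_{j=1}^n\overline{\mathcal E_j}$ in time at most $$\max\Big(2,\frac{nm}{\alpha}\Big)^{C\,\log(\max(2,d))\,\sqrt{m/\alpha}} .$$ -/

import Mathlib

namespace LLL

/-! ### The alternating-sign independence polynomial and the Shearer region -/

open Classical in
/-- The alternating-sign independence polynomial of the subgraph induced on `S`: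
the sum of `(-1)^|I| * ∏_{v ∈ I} p_v` over the independent sets `I ⊆ S`. -/
noncomputable def qBreve {V : Type*} (G : SimpleGraph V) (S : Finset V) (p : V → ℝ) : ℝ :=
  ∑ I ∈ S.powerset.filter (fun I : Finset V => G.IsIndepSet (I : Set V)),
    (-1) ^ I.card * ∏ v ∈ I, p v

/-- The Shearer region: probability vectors at which all the polynomials `qBreve` are positive. -/
def shearerRegion {V : Type*} (G : SimpleGraph V) : Set (V → ℝ) :=
  {p | (∀ v, 0 ≤ p v ∧ p v ≤ 1) ∧ ∀ S : Finset V, 0 < qBreve G S p}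

/-! ### The variable model -/

/-- `n` events over `m` Boolean variables; the event `j` is determined by the variables in
`vars j`. -/
structure VariableModel (n m : ℕ) where
  vars : Fin n → Finset (Fin m)
  event : Fin n → Set (Fin m → Bool)
  event_congr : ∀ (j : Fin n) (ω ω' : Fin m → Bool), (∀ i ∈ vars j, ω i = ω' i) →
    (ω ∈ event j ↔ ω' ∈ event j)

/-- The dependency graph: distinct events are adjacent if they share a variable. -/
def VariableModel.depGraph {n m : ℕ} (M : VariableModel n m) : SimpleGraph (Fin n) where
  Adj j k := j ≠ k ∧ (M.vars j ∩ M.vars k).Nonempty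
  symm := ⟨fun _ _ h => ⟨h.1.symm, by rw [Finset.inter_comm]; exact h.2⟩⟩
  loopless := ⟨fun _ h => h.1 rfl⟩

open Classical in
/-- The maximum degree of the dependency graph. -/
noncomputable def VariableModel.maxDegree {n m : ℕ} (M : VariableModel n m) : ℕ :=
  M.depGraph.maxDegree

/-- The mass of the point `ω` under the product distribution on `{0,1}^m` with expectation `z`. -/
noncomputable def productWeight {m : ℕ} (z : Fin m → ℝ) (ω : Fin m → Bool) : ℝ :=
  ∏ i, if ω i then z i else 1 - z i

open Classical in
/-- The probabilities `p_j(z)` of the events under the product distribution with expectation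
`z`. -/
noncomputable def VariableModel.prob {n m : ℕ} (M : VariableModel n m) (z : Fin m → ℝ) :
    Fin n → ℝ :=
  fun j => ∑ ω : Fin m → Bool with ω ∈ M.event j, productWeight z ω

/-! ### Deterministic programs with unit-cost real arithmetic

A program is a finite system of first-order, possibly recursive, call-by-value functions on
binary trees with real leaves. Every elementary operation costs one step: an exact arithmetic
operation or comparison of two reals, access to a variable, forming a pair, taking a component of
a pair, testing whether a tree is a pair, a local definition, a function call. Trees are
represented by pointers, so none of these operations copies or compares trees. Up to polynomial
factors this is the cost measure of the real RAM. There is no rounding operation, and the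
constants in a program are rational. -/

/-- Data: binary trees with real leaves. -/
inductive Val where
  | nil : Val
  | num (x : ℝ) : Val
  | pair (a b : Val) : Val

/-- The arithmetic operations. -/
inductive ArithOp where
  | add | sub | mul | div

/-- Exact arithmetic; as always in Lean, `x / 0 = 0`. -/
noncomputable def ArithOp.apply : ArithOp → ℝ → ℝ → ℝ
  | .add, x, y => x + y
  | .sub, x, y => x - y
  | .mul, x, y => x * y
  | .div, x, y => x / y

/-- Expressions; `var i` is the `i`-th variable, counted from the innermost binder. -/
inductive Code where
  | var (i : ℕ) : Code
  | nil : Code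
  | const (q : ℚ) : Code
  | arith (o : ArithOp) (a b : Code) : Code
  | pair (a b : Code) : Code
  | fst (a : Code) : Code
  | snd (a : Code) : Code
  | ifLe (a b yes no : Code) : Code
  | ifPair (a yes no : Code) : Code
  | letIn (a body : Code) : Code
  | call (f : ℕ) (arg : Code) : Code

/-- `Steps defs env e v t`: with the function bodies `defs` and the values `env` of the variables,
the expression `e` evaluates to `v` in `t` steps. There is no such `v`, `t` if the evaluation does
not terminate or applies an operation to data of the wrong shape. -/
inductive Steps (defs : List Code) : List Val → Code → Val → ℕ → Prop where
  | var {env : List Val} {i : ℕ} {v : Val} (h : env[i]? = some v) : Steps defs env (.var i) v 1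
  | nil {env : List Val} : Steps defs env .nil .nil 1
  | const {env : List Val} {q : ℚ} : Steps defs env (.const q) (.num (q : ℝ)) 1
  | arith {env : List Val} {o : ArithOp} {a b : Code} {x y : ℝ} {s t : ℕ}
      (ha : Steps defs env a (.num x) s) (hb : Steps defs env b (.num y) t) :
      Steps defs env (.arith o a b) (.num (o.apply x y)) (s + t + 1)
  | pair {env : List Val} {a b : Code} {u v : Val} {s t : ℕ}
      (ha : Steps defs env a u s) (hb : Steps defs env b v t) :
      Steps defs env (.pair a b) (.pair u v) (s + t + 1)
  | fst {env : List Val} {a : Code} {u v : Val} {s : ℕ} (ha : Steps defs env a (.pair u v) s) :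
      Steps defs env (.fst a) u (s + 1)
  | snd {env : List Val} {a : Code} {u v : Val} {s : ℕ} (ha : Steps defs env a (.pair u v) s) :
      Steps defs env (.snd a) v (s + 1)
  | ifLe_yes {env : List Val} {a b yes no : Code} {x y : ℝ} {v : Val} {r s t : ℕ}
      (ha : Steps defs env a (.num x) r) (hb : Steps defs env b (.num y) s) (h : x ≤ y)
      (hv : Steps defs env yes v t) :
      Steps defs env (.ifLe a b yes no) v (r + s + t + 1)
  | ifLe_no {env : List Val} {a b yes no : Code} {x y : ℝ} {v : Val} {r s t : ℕ}
      (ha : Steps defs env a (.num x) r) (hb : Steps defs env b (.num y) s) (h : y < x)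
      (hv : Steps defs env no v t) :
      Steps defs env (.ifLe a b yes no) v (r + s + t + 1)
  | ifPair_yes {env : List Val} {a yes no : Code} {u w v : Val} {s t : ℕ}
      (ha : Steps defs env a (.pair u w) s) (hv : Steps defs env yes v t) :
      Steps defs env (.ifPair a yes no) v (s + t + 1)
  | ifPair_no {env : List Val} {a yes no : Code} {u v : Val} {s t : ℕ}
      (ha : Steps defs env a u s) (h : ∀ x y, u ≠ .pair x y) (hv : Steps defs env no v t) :
      Steps defs env (.ifPair a yes no) v (s + t + 1)
  | letIn {env : List Val} {a body : Code} {u v : Val} {s t : ℕ}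
      (ha : Steps defs env a u s) (hv : Steps defs (u :: env) body v t) :
      Steps defs env (.letIn a body) v (s + t + 1)
  | call {env : List Val} {f : ℕ} {arg body : Code} {u v : Val} {s t : ℕ}
      (ha : Steps defs env arg u s) (hf : defs[f]? = some body)
      (hv : Steps defs [u] body v t) :
      Steps defs env (.call f arg) v (s + t + 1)

/-- Computation is deterministic: the value and the number of steps are unique. -/
theorem Steps.deterministic {defs : List Code} {env : List Val} {e : Code} {v v' : Val}
    {t t' : ℕ} (h : Steps defs env e v t) (h' : Steps defs env e v' t') : v = v' ∧ t = t' := by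
  induction h generalizing v' t' with
  | var h => cases h' with | var h2 => simp_all
  | nil => cases h'; simp
  | const => cases h'; simp
  | arith ha hb iha ihb =>
    cases h' with
    | arith ha' hb' =>
      obtain ⟨h1, rfl⟩ := iha ha'
      obtain ⟨h2, rfl⟩ := ihb hb'
      cases h1; cases h2; simp
  | pair ha hb iha ihb =>
    cases h' with
    | pair ha' hb' =>
      obtain ⟨rfl, rfl⟩ := iha ha'
      obtain ⟨rfl, rfl⟩ := ihb hb'
      simp
  | fst ha iha =>
    cases h' with
    | fst ha' => obtain ⟨h1, rfl⟩ := iha ha'; cases h1; simp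
  | snd ha iha =>
    cases h' with
    | snd ha' => obtain ⟨h1, rfl⟩ := iha ha'; cases h1; simp
  | ifLe_yes ha hb h hv iha ihb ihv =>
    cases h' with
    | ifLe_yes ha' hb' h' hv' =>
      obtain ⟨h1, rfl⟩ := iha ha'
      obtain ⟨h2, rfl⟩ := ihb hb'
      obtain ⟨rfl, rfl⟩ := ihv hv'
      simp
    | ifLe_no ha' hb' h' hv' =>
      obtain ⟨h1, rfl⟩ := iha ha'
      obtain ⟨h2, rfl⟩ := ihb hb'
      cases h1; cases h2; exact absurd h (not_le.mpr h')
  | ifLe_no ha hb h hv iha ihb ihv =>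
    cases h' with
    | ifLe_no ha' hb' h' hv' =>
      obtain ⟨h1, rfl⟩ := iha ha'
      obtain ⟨h2, rfl⟩ := ihb hb'
      obtain ⟨rfl, rfl⟩ := ihv hv'
      simp
    | ifLe_yes ha' hb' h' hv' =>
      obtain ⟨h1, rfl⟩ := iha ha'
      obtain ⟨h2, rfl⟩ := ihb hb'
      cases h1; cases h2; exact absurd h' (not_le.mpr h)
  | ifPair_yes ha hv iha ihv =>
    cases h' with
    | ifPair_yes ha' hv' =>
      obtain ⟨h1, rfl⟩ := iha ha'
      obtain ⟨rfl, rfl⟩ := ihv hv'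
      simp
    | ifPair_no ha' h' hv' =>
      obtain ⟨h1, rfl⟩ := iha ha'
      exact absurd h1.symm (h' _ _)
  | ifPair_no ha h hv iha ihv =>
    cases h' with
    | ifPair_no ha' h' hv' =>
      obtain ⟨h1, rfl⟩ := iha ha'
      obtain ⟨rfl, rfl⟩ := ihv hv'
      simp
    | ifPair_yes ha' hv' =>
      obtain ⟨h1, rfl⟩ := iha ha'
      exact absurd h1 (h _ _)
  | letIn ha hv iha ihv =>
    cases h' with
    | letIn ha' hv' =>
      obtain ⟨rfl, rfl⟩ := iha ha'
      obtain ⟨rfl, rfl⟩ := ihv hv'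
      simp
  | call ha hf hv iha ihv =>
    cases h' with
    | call ha' hf' hv' =>
      obtain ⟨rfl, rfl⟩ := iha ha'
      rw [hf] at hf'
      cases hf'
      obtain ⟨rfl, rfl⟩ := ihv hv'
      simp

/-- A program: the bodies of its functions, and the main expression, whose only variable is the
input. -/
structure Program where
  defs : List Code
  main : Code

/-- On the given input, the program halts after exactly `t` steps with the given output. -/
def Program.Runs (P : Program) (input output : Val) (t : ℕ) : Prop :=
  Steps P.defs [input] P.main output t

/-! ### Inputs and outputs -/

/-- The tree that represents a list. -/
def Val.ofList : List Val → Val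
  | [] => .nil
  | a :: l => .pair a (Val.ofList l)

/-- A real vector, as the list of its coordinates. -/
def encodeVec {k : ℕ} (x : Fin k → ℝ) : Val :=
  Val.ofList (List.ofFn fun i => Val.num (x i))

/-- A point of `{0,1}^m`, as a list of zeros and ones. -/
def encodePoint {m : ℕ} (ω : Fin m → Bool) : Val :=
  encodeVec fun i => if ω i then (1 : ℝ) else 0

/-- The sets `vars j`, as the list of the rows of the 0/1 incidence matrix of events and
variables. -/
def VariableModel.encodeVars {n m : ℕ} (M : VariableModel n m) : Val :=
  Val.ofList (List.ofFn fun j => encodeVec fun i => if i ∈ M.vars j then (1 : ℝ) else 0)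

/-- A format for describing events: `D n m M w` says that the tree `w`, together with the sets of
variables of `M`, is a description of `M`. -/
abbrev DescriptionFormat : Type := (n m : ℕ) → VariableModel n m → Val → Prop

/-- For instances described in the format `D`, the program `Q` computes the vector of the
probabilities of the events from the description and from `z ∈ [0,1]^m`, in at most
`(n + m + 1)^c` steps. -/
def ComputesProb (D : DescriptionFormat) (Q : Program) (c : ℕ) : Prop :=
  ∀ (n m : ℕ) (M : VariableModel n m) (w : Val), D n m M w →
    ∀ z : Fin m → ℝ, (∀ i, 0 ≤ z i ∧ z i ≤ 1) →
      ∃ t : ℕ, Q.Runs (.pair (.pair M.encodeVars w) (encodeVec z)) (encodeVec (M.prob z)) t ∧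
        t ≤ (n + m + 1) ^ c

end LLL

/-! The variables are rounded one at a time, as in the method of conditional expectations, with the
independence polynomial `q` as potential. While `k` variables remain, the invariant is that `(1 + k
* α / m) • p(z)` is in the positive region: the factor is `1 + α` at the start and `1` at the end.
At a vertex of the cube each `p_j` is 0 or 1, and positivity for the set `{j}` says `p_j < 1`, so no
event occurs.

The events that depend on variable `i` form a clique `C`. Hence every polynomial is affine in the
coordinates in `C`, and changing these by `Δ_j` changes `q(V)` by `-q(V) * ∑_{j ∈ C} Δ_j w_j` with
`w_j = q(V \ N[j]) / q(V)`. As `p(z)` is affine in `z_i`, one of the values 0, 1 does not increase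
`∑ p_j w_j`, so `q(V)` does not drop. Watching `q(V)` is enough (`Positive.of_clique`): on the
segment between the two vectors, the first polynomial to vanish would force `q(V) ≤ 0` at that
point, by monotonicity in the vertex set.

The weights `w_j` are only approximated, by a tree recursion cut off at depth `l` (`approxRatio`),
which costs about `(d + 2) ^ l`. The error is measured against the gap between the recursions at `p`
and at `(1 + δ) • p`. By `contraction` each level shrinks it by the factor `1 - θ` if `θ ^ 2 ≤ log
(1 + δ)`, so the rate is of the order of the square root of the slack. With `δ = α / (6 m)`, depth
of order `√(m / α) * log (n m / α)` suffices, and `VariableModel.positive_update` pays for each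
rounding with a factor `(1 + δ) ^ 2` of slack. The rest realizes this as a program and counts its
steps. -/

namespace LLL

/-! ### The independence polynomial -/

section Shearer

variable {V : Type*} [DecidableEq V] {G : SimpleGraph V}

open Classical in
theorem qBreve_eq_sum_powerset (S : Finset V) (p : V → ℝ) :
    qBreve G S p = ∑ I ∈ S.powerset,
      if G.IsIndepSet (I : Set V) then (-1) ^ I.card * ∏ v ∈ I, p v else 0 := by
  rw [qBreve, Finset.sum_filter]
  exact Finset.sum_congr rfl fun I _ => by congr

theorem qBreve_empty (p : V → ℝ) : qBreve G ∅ p = 1 := by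
  simp [qBreve_eq_sum_powerset, SimpleGraph.IsIndepSet]

theorem qBreve_congr {S : Finset V} {p p' : V → ℝ} (h : ∀ v ∈ S, p v = p' v) :
    qBreve G S p = qBreve G S p' := by
  classical
  simp only [qBreve_eq_sum_powerset]
  refine Finset.sum_congr rfl fun I hI => ?_
  rw [Finset.prod_congr rfl fun v hv => h v (Finset.mem_powerset.1 hI hv)]

-- The independent sets that contain `v` are the sets `insert v I` with `I` independent and free of
-- neighbours of `v`.
open Classical in
theorem qBreve_insert {S : Finset V} {v : V} (hv : v ∉ S) (p : V → ℝ) :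
    qBreve G (insert v S) p =
      qBreve G S p - p v * qBreve G (S.filter fun u => ¬ G.Adj v u) p := by
  simp only [qBreve_eq_sum_powerset]
  rw [Finset.sum_powerset_insert hv, sub_eq_add_neg, add_right_inj, ← neg_mul, Finset.mul_sum,
    ← Finset.sum_subset (Finset.powerset_mono.2 (Finset.filter_subset (fun u => ¬ G.Adj v u) S))]
  · refine Finset.sum_congr rfl fun I hI => ?_
    rw [Finset.mem_powerset] at hI
    have hvI : v ∉ I := fun h => hv (Finset.mem_filter.1 (hI h)).1
    have key : G.IsIndepSet ((insert v I : Finset V) : Set V) ↔ G.IsIndepSet (I : Set V) := by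
      constructor
      · exact fun h => h.mono (by simp)
      · intro h
        rw [Finset.coe_insert, SimpleGraph.IsIndepSet, Set.pairwise_insert]
        exact ⟨h, fun u hu _ => ⟨(Finset.mem_filter.1 (hI hu)).2,
          fun h' => (Finset.mem_filter.1 (hI hu)).2 h'.symm⟩⟩
    rw [if_congr key rfl rfl, Finset.card_insert_of_notMem hvI, Finset.prod_insert hvI]
    split_ifs <;> ring
  · intro I hI hI'
    rw [Finset.mem_powerset] at hI hI'
    rw [if_neg]
    intro h
    refine hI' fun u hu => Finset.mem_filter.2 ⟨hI hu, ?_⟩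
    exact h (by simp) (by simp [hu]) (fun h => hv (hI (h ▸ hu)))

/-- All the polynomials are positive at the nonnegative vector `p`. -/
def Positive (G : SimpleGraph V) (p : V → ℝ) : Prop :=
  (∀ v, 0 ≤ p v) ∧ ∀ S : Finset V, 0 < qBreve G S p

/-- Adding a vertex subtracts a nonnegative term. Only weak inequalities are assumed, because the
lemma is applied at a boundary point of the region. -/
theorem qBreve_anti {p : V → ℝ} (hp : ∀ v, 0 ≤ p v) (h : ∀ S : Finset V, 0 ≤ qBreve G S p)
    {S T : Finset V} (hST : S ⊆ T) : qBreve G T p ≤ qBreve G S p := by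
  classical
  obtain ⟨U, rfl⟩ : ∃ U, T = U ∪ S := ⟨T, by simp [hST]⟩
  clear hST
  induction U using Finset.induction_on with
  | empty => simp
  | insert v U _ ih =>
    rw [Finset.insert_union]
    by_cases hv : v ∈ U ∪ S
    · rwa [Finset.insert_eq_self.2 hv]
    · rw [qBreve_insert hv]
      have := mul_nonneg (hp v) (h ((U ∪ S).filter fun u => ¬ G.Adj v u))
      linarith

theorem qBreve_singleton (v : V) (p : V → ℝ) : qBreve G {v} p = 1 - p v := by
  have := qBreve_insert (G := G) (Finset.notMem_empty v) p
  simpa [qBreve_empty] using this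

open Classical in
/-- For a clique `C`, the polynomial is affine in the coordinates in `C`. -/
theorem qBreve_clique {C : Finset V} (hC : G.IsClique (C : Set V)) (U : Finset V) (p : V → ℝ) :
    qBreve G U p = qBreve G (U \ C) p -
      ∑ j ∈ U ∩ C, p j * qBreve G (U.filter fun u => u ≠ j ∧ ¬ G.Adj j u) p := by
  have key : ∀ D : Finset V, D ⊆ U ∩ C → qBreve G (U \ C ∪ D) p = qBreve G (U \ C) p -
      ∑ j ∈ D, p j * qBreve G (U.filter fun u => u ≠ j ∧ ¬ G.Adj j u) p := by
    intro D
    induction D using Finset.induction_on with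
    | empty => simp
    | insert v D hv ih =>
      intro hD
      have hvUC := Finset.mem_inter.1 (hD (Finset.mem_insert_self v D))
      have hDs : D ⊆ U ∩ C := fun x hx => hD (Finset.mem_insert_of_mem hx)
      rw [Finset.sum_insert hv, Finset.union_insert, qBreve_insert (by simp [hv, hvUC.2]),
        ih hDs]
      have : (U \ C ∪ D).filter (fun u => ¬ G.Adj v u) =
          U.filter fun u => u ≠ v ∧ ¬ G.Adj v u := by
        ext u
        simp only [Finset.mem_filter, Finset.mem_union, Finset.mem_sdiff]
        constructor
        · rintro ⟨⟨hu, huC⟩ | hu, ha⟩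
          · exact ⟨hu, fun e => huC (e ▸ hvUC.2), ha⟩
          · exact ⟨(Finset.mem_inter.1 (hDs hu)).1, fun e => hv (e ▸ hu), ha⟩
        · rintro ⟨hu, hne, ha⟩
          exact ⟨Or.inl ⟨hu, fun huC => ha (hC (by exact_mod_cast hvUC.2)
            (by exact_mod_cast huC) hne.symm)⟩, ha⟩
      rw [this]
      ring
  rw [← key _ subset_rfl]
  congr 1
  ext x
  simp only [Finset.mem_union, Finset.mem_sdiff, Finset.mem_inter]
  tauto

-- The coefficients in `qBreve_clique` do not involve the coordinates in `C`, since deleting the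
-- closed neighbourhood of `j` deletes the whole clique. So the increment is exactly linear.
open Classical in
theorem qBreve_clique_sub {C : Finset V} (hC : G.IsClique (C : Set V)) (U : Finset V)
    {p p' : V → ℝ} (hpp' : ∀ v, v ∉ C → p' v = p v) :
    qBreve G U p' = qBreve G U p -
      ∑ j ∈ U ∩ C, (p' j - p j) * qBreve G (U.filter fun u => u ≠ j ∧ ¬ G.Adj j u) p := by
  have h1 : qBreve G (U \ C) p' = qBreve G (U \ C) p :=
    qBreve_congr fun v hv => hpp' v (Finset.mem_sdiff.1 hv).2
  have h2 : ∑ j ∈ U ∩ C, p' j * qBreve G (U.filter fun u => u ≠ j ∧ ¬ G.Adj j u) p' =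
      ∑ j ∈ U ∩ C, p' j * qBreve G (U.filter fun u => u ≠ j ∧ ¬ G.Adj j u) p := by
    refine Finset.sum_congr rfl fun j hj => ?_
    congr 1
    refine qBreve_congr fun v hv => hpp' v fun hvC => ?_
    obtain ⟨-, hne, ha⟩ := Finset.mem_filter.1 hv
    exact ha (hC (by exact_mod_cast (Finset.mem_inter.1 hj).2) (by exact_mod_cast hvC) hne.symm)
  rw [qBreve_clique hC U p', qBreve_clique hC U p, h1, h2]
  simp only [sub_mul, Finset.sum_sub_distrib]
  ring

/-- Changing the probabilities on a clique preserves positivity, if the polynomial of the whole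
graph stays positive. -/
theorem Positive.of_clique [Fintype V] {C : Finset V} (hC : G.IsClique (C : Set V))
    {p p' : V → ℝ} (hp : Positive G p) (hpp' : ∀ v, v ∉ C → p' v = p v) (hp' : ∀ v, 0 ≤ p' v)
    (hq : 0 < qBreve G Finset.univ p') : Positive G p' := by
  classical
  refine ⟨hp', ?_⟩
  by_contra! hneg
  let a : Finset V → ℝ := fun U => qBreve G U p
  let b : Finset V → ℝ := fun U => qBreve G U p'
  have ha : ∀ U, 0 < a U := hp.2
  obtain ⟨U₀, hU₀⟩ := hneg
  have hne : ((Finset.univ : Finset (Finset V)).filter fun U => b U ≤ 0).Nonempty :=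
    ⟨U₀, by simpa [b] using hU₀⟩
  -- For `b U ≤ 0`, the polynomial of `U` vanishes on the segment from `p` to `p'` at time `a U / (a
  -- U - b U)`; take the earliest such time.
  obtain ⟨U, hU, hmin⟩ := Finset.exists_min_image _ (fun U => a U / (a U - b U)) hne
  have hbU : b U ≤ 0 := (Finset.mem_filter.1 hU).2
  have hd : 0 < a U - b U := by linarith [ha U]
  set s := a U / (a U - b U) with hs
  have hs0 : 0 < s := div_pos (ha U) hd
  have hs1 : s ≤ 1 := by rw [hs, div_le_one hd]; linarith
  let r : V → ℝ := fun v => p v + s * (p' v - p v)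
  have hr : ∀ v, 0 ≤ r v := fun v => by
    have h1 : r v = (1 - s) * p v + s * p' v := by simp only [r]; ring
    rw [h1]
    exact add_nonneg (mul_nonneg (by linarith) (hp.1 v)) (mul_nonneg hs0.le (hp' v))
  have hqr : ∀ W, qBreve G W r = a W + s * (b W - a W) := by
    intro W
    have h1 := qBreve_clique_sub hC W hpp'
    have h2 := qBreve_clique_sub hC W (p := p) (p' := r) (fun v hv => by simp [r, hpp' v hv])
    simp only [a, b, h1, h2, r, add_sub_cancel_left, mul_assoc, ← Finset.mul_sum]
    ring
  have hqr0 : ∀ W, 0 ≤ qBreve G W r := by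
    intro W
    rw [hqr]
    by_cases hW : b W ≤ 0
    · have hdW : 0 < a W - b W := by linarith [ha W]
      have := hmin W (Finset.mem_filter.2 ⟨Finset.mem_univ _, hW⟩)
      rw [le_div_iff₀ hdW] at this
      linarith
    · push Not at hW
      nlinarith [ha W]
  have h0 : qBreve G U r = 0 := by
    rw [hqr, hs]
    field_simp
    ring
  -- At time `s` all polynomials are nonnegative and that of `U` is zero, so that of the whole graph
  -- is at most zero. But it is affine in time and positive at both ends.
  have h1 := qBreve_anti hr hqr0 (Finset.subset_univ U)
  rw [h0, hqr] at h1
  have h2 : 0 < b Finset.univ := hq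
  nlinarith [ha Finset.univ]

/-- Positivity is inherited by smaller vectors. -/
theorem Positive.mono [Fintype V] {p p' : V → ℝ} (hp' : Positive G p') (hp : ∀ v, 0 ≤ p v)
    (hpp' : ∀ v, p v ≤ p' v) : Positive G p := by
  classical
  have key : ∀ T : Finset V, Positive G (fun v => if v ∈ T then p v else p' v) := by
    intro T
    induction T using Finset.induction_on with
    | empty => simpa using hp'
    | insert w T hw ih =>
      -- The coordinates are lowered one by one; a single vertex is a clique.
      have hcl : G.IsClique (({w} : Finset V) : Set V) := by simp
      have hoff : ∀ v, v ∉ ({w} : Finset V) → (if v ∈ insert w T then p v else p' v) =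
          if v ∈ T then p v else p' v := by
        intro v hv
        have : v ≠ w := by simpa using hv
        simp [this]
      refine ih.of_clique hcl hoff (fun v => ?_) ?_
      · split_ifs
        exacts [hp v, hp'.1 v]
      · rw [qBreve_clique_sub hcl _ hoff]
        simp only [Finset.univ_inter, Finset.sum_singleton, Finset.mem_insert_self, if_true, hw,
          if_false]
        have h1 := ih.2 Finset.univ
        have h2 := ih.2 (Finset.univ.filter fun u => u ≠ w ∧ ¬ G.Adj w u)
        have h3 := mul_nonneg (sub_nonneg.2 (hpp' w)) h2.le
        nlinarith
  have := key Finset.univ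
  simpa using this

end Shearer

theorem Positive.of_mem_shearerRegion {V : Type*} {G : SimpleGraph V} {p : V → ℝ} (h : p ∈ shearerRegion G) : Positive G p :=
  ⟨fun v => (h.1 v).1, h.2⟩

/-! ### Decay of correlations -/

/-- The negative logarithm of `1 - x`. -/
noncomputable def negLog (x : ℝ) : ℝ := -Real.log (1 - x)

theorem negLog_mono {x y : ℝ} (h : x ≤ y) (hy : y < 1) : negLog x ≤ negLog y :=
  neg_le_neg (Real.log_le_log (by linarith) (by linarith))

theorem negLog_nonneg {x : ℝ} (h0 : 0 ≤ x) (h1 : x < 1) : 0 ≤ negLog x := by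
  have := negLog_mono h0 h1
  simpa [negLog] using this

theorem negLog_sub_le {x y : ℝ} (hx : x < 1) (hy : y < 1) :
    negLog x - negLog y ≤ (x - y) / (1 - x) := by
  have hx' : 0 < 1 - x := by linarith
  have hy' : 0 < 1 - y := by linarith
  have h := Real.log_le_sub_one_of_pos (div_pos hy' hx')
  rw [Real.log_div hy'.ne' hx'.ne'] at h
  have : (1 - y) / (1 - x) - 1 = (x - y) / (1 - x) := by field_simp; ring
  rw [negLog, negLog]
  linarith

/-- One level of the recursion in logarithmic scale: `x` is the exact value, `x * exp (-a)` the
approximation and `x * exp T` the value with slack. Both differences of `negLog` are compared with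
`x / (1 - x)`: the error is at most this times `a`, the gap at least this times `T + T ^ 2 / 2`. The
quadratic term is what produces a rate of order `√β`. -/
theorem contraction {x a T β lam θ : ℝ} (hx : 0 ≤ x) (hy : x * Real.exp T < 1) (ha : 0 ≤ a)
    (hβ : 0 ≤ β) (hT : β ≤ T) (haT : a ≤ lam * (T - β)) (hθ1 : θ ≤ 1 / 2)
    (hθβ : θ ^ 2 ≤ β) (hlam : 0 ≤ lam) :
    negLog x - negLog (x * Real.exp (-a)) ≤
      lam * (1 - θ) * (negLog (x * Real.exp T) - negLog x) := by
  have hT0 : 0 ≤ T := hβ.trans hT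
  have hx1 : x < 1 := lt_of_le_of_lt (le_mul_of_one_le_right hx (Real.one_le_exp hT0)) hy
  have hx' : 0 < 1 - x := by linarith
  have hσ : 0 ≤ x / (1 - x) := div_nonneg hx hx'.le
  have hxa : x * Real.exp (-a) < 1 :=
    lt_of_le_of_lt (mul_le_of_le_one_right hx (Real.exp_le_one_iff.2 (by linarith))) hx1
  have h1 : negLog x - negLog (x * Real.exp (-a)) ≤ x / (1 - x) * a := by
    refine (negLog_sub_le hx1 hxa).trans ?_
    rw [div_mul_eq_mul_div]
    refine div_le_div_of_nonneg_right ?_ hx'.le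
    nlinarith [Real.add_one_le_exp (-a)]
  have h2 : x / (1 - x) * (T + T ^ 2 / 2) ≤ negLog (x * Real.exp T) - negLog x := by
    have hy' : 0 < 1 - x * Real.exp T := by linarith
    have h := Real.log_le_sub_one_of_pos (div_pos hy' hx')
    rw [Real.log_div hy'.ne' hx'.ne'] at h
    have e : (1 - x * Real.exp T) / (1 - x) - 1 = - (x / (1 - x) * (Real.exp T - 1)) := by
      field_simp; ring
    have h3 : x / (1 - x) * (T + T ^ 2 / 2) ≤ x / (1 - x) * (Real.exp T - 1) :=
      mul_le_mul_of_nonneg_left (by linarith [Real.quadratic_le_exp_of_nonneg hT0]) hσ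
    rw [negLog, negLog]
    linarith
  -- With `β` replaced by `θ ^ 2`, right side minus left side is `(θ - T / 2) ^ 2 + (1 / 2 - θ) * T
  -- ^ 2 / 2`.
  have h3 : T - β ≤ (1 - θ) * (T + T ^ 2 / 2) := by
    nlinarith [sq_nonneg (θ - T / 2), mul_nonneg (sub_nonneg.2 hθ1) (sq_nonneg T)]
  calc _ ≤ x / (1 - x) * a := h1
    _ ≤ x / (1 - x) * (lam * (T - β)) := mul_le_mul_of_nonneg_left haT hσ
    _ ≤ x / (1 - x) * (lam * ((1 - θ) * (T + T ^ 2 / 2))) := by gcongr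
    _ = lam * (1 - θ) * (x / (1 - x) * (T + T ^ 2 / 2)) := by ring
    _ ≤ _ := mul_le_mul_of_nonneg_left h2 (mul_nonneg hlam (by linarith))

/-! ### The truncated tree recursion and its error -/

section Decay

variable {V : Type*}

/-- The product of the factors `1 / (1 - X u T)` along the list `N`, whose elements are moved one
by one to the list `R`. -/
noncomputable def foldRatio (X : V → List V → ℝ) : List V → List V → ℝ
  | [], _ => 1
  | u :: N, R => foldRatio X N (u :: R) / (1 - X u R)

/-- The tree recursion for ratios of independence polynomials, truncated at depth `l`. -/
noncomputable def approxRatio (adj : V → V → Prop) [DecidableRel adj] (p : V → ℝ) :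
    ℕ → V → List V → ℝ
  -- The cut-off value 0 keeps all approximations below the exact values.
  | 0, _, _ => 0
  | l + 1, v, S => foldRatio (fun u T => p u * approxRatio adj p l u T)
      (S.filter fun u => adj v u) (S.filter fun u => ¬ adj v u)

theorem foldRatio_pos {X : V → List V → ℝ} (N R : List V) (h : (N ++ R).Nodup)
    (hX : ∀ u T, u ∉ T → T.Nodup → X u T < 1) : 0 < foldRatio X N R := by
  induction N generalizing R with
  | nil => simp [foldRatio]
  | cons u N ih =>
    rw [List.cons_append, List.nodup_cons, List.mem_append, not_or] at h
    have h' : (N ++ u :: R).Nodup := by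
      rw [List.nodup_middle, List.nodup_cons, List.mem_append, not_or]; exact h
    exact div_pos (ih _ h') (sub_pos.2 (hX u R h.1.2 h.2.of_append_right))

/-- The comparison is only required on lists shorter than `k`, so that the lemma serves in
inductions on the length. -/
theorem foldRatio_mono {X Y : V → List V → ℝ} (k : ℕ) (N R : List V) (h : (N ++ R).Nodup)
    (hk : N.length + R.length ≤ k)
    (hXY : ∀ u T, u ∉ T → T.Nodup → T.length < k → X u T ≤ Y u T)
    (hY : ∀ u T, u ∉ T → T.Nodup → Y u T < 1) : foldRatio X N R ≤ foldRatio Y N R := by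
  induction N generalizing R with
  | nil => simp [foldRatio]
  | cons u N ih =>
    rw [List.cons_append, List.nodup_cons, List.mem_append, not_or] at h
    have h' : (N ++ u :: R).Nodup := by
      rw [List.nodup_middle, List.nodup_cons, List.mem_append, not_or]; exact h
    have hR := h.2.of_append_right
    simp only [List.length_cons] at hk
    have h1 := hY u R h.1.2 hR
    have h2 := hXY u R h.1.2 hR (by omega)
    have h3 := foldRatio_pos N (u :: R) h' hY
    exact div_le_div₀ h3.le (ih _ h' (by simp; omega)) (by linarith) (by linarith)

theorem log_foldRatio_cons {X : V → List V → ℝ} {u : V} {N R : List V}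
    (h : (N ++ u :: R).Nodup) (hX : ∀ u T, u ∉ T → T.Nodup → X u T < 1) :
    Real.log (foldRatio X (u :: N) R) = Real.log (foldRatio X N (u :: R)) + negLog (X u R) := by
  have h2 := List.nodup_cons.1 h.of_append_right
  have h1 : 0 < 1 - X u R := sub_pos.2 (hX u R h2.1 h2.2)
  rw [foldRatio, Real.log_div (foldRatio_pos N _ h hX).ne' h1.ne', negLog]
  ring

theorem log_foldRatio_le {X X' : V → List V → ℝ} {B : ℝ} (N R : List V) (h : (N ++ R).Nodup)
    (hX : ∀ u T, u ∉ T → T.Nodup → X u T < 1) (hX' : ∀ u T, u ∉ T → T.Nodup → X' u T < 1)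
    (hB : ∀ u T, u ∉ T → T.Nodup → negLog (X u T) - negLog (X' u T) ≤ B) :
    Real.log (foldRatio X N R) - Real.log (foldRatio X' N R) ≤ N.length * B := by
  induction N generalizing R with
  | nil => simp [foldRatio]
  | cons u N ih =>
    have h' : (N ++ u :: R).Nodup := by rwa [List.nodup_middle]
    have h2 := List.nodup_cons.1 h'.of_append_right
    rw [log_foldRatio_cons h' hX, log_foldRatio_cons h' hX']
    have := ih _ h'
    have := hB u R h2.1 h2.2
    push_cast [List.length_cons]
    linarith

/-- Logarithms turn the product into a sum, and a linear inequality between the terms can be summed.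
-/
theorem log_foldRatio_compare {X X' Y : V → List V → ℝ} {lam : ℝ} (N R : List V)
    (h : (N ++ R).Nodup) (hX : ∀ u T, u ∉ T → T.Nodup → X u T < 1)
    (hX' : ∀ u T, u ∉ T → T.Nodup → X' u T < 1) (hY : ∀ u T, u ∉ T → T.Nodup → Y u T < 1)
    (hB : ∀ u T, u ∉ T → T.Nodup →
      negLog (X u T) - negLog (X' u T) ≤ lam * (negLog (Y u T) - negLog (X u T))) :
    Real.log (foldRatio X N R) - Real.log (foldRatio X' N R) ≤
      lam * (Real.log (foldRatio Y N R) - Real.log (foldRatio X N R)) := by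
  induction N generalizing R with
  | nil => simp [foldRatio]
  | cons u N ih =>
    have h' : (N ++ u :: R).Nodup := by rwa [List.nodup_middle]
    have h2 := List.nodup_cons.1 h'.of_append_right
    rw [log_foldRatio_cons h' hX, log_foldRatio_cons h' hX', log_foldRatio_cons h' hY]
    have := ih _ h'
    have := hB u R h2.1 h2.2
    linarith

theorem nodup_filter_append {S : List V} (hS : S.Nodup) (P : V → Prop) [DecidablePred P] :
    ((S.filter fun u => P u) ++ S.filter fun u => ¬ P u).Nodup := by
  refine List.Nodup.append (hS.filter _) (hS.filter _) fun x h1 h2 => ?_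
  simp at h1 h2
  exact h2.2 h1.2

variable [DecidableEq V] {G : SimpleGraph V}

open Classical in
/-- The exact value of the quantity approximated by `p v * approxRatio adj p l v S`. -/
noncomputable def occ (G : SimpleGraph V) (p : V → ℝ) (v : V) (S : List V) : ℝ :=
  p v * (qBreve G (S.toFinset.filter fun u => ¬ G.Adj v u) p / qBreve G S.toFinset p)

theorem one_sub_occ {p : V → ℝ} (hp : Positive G p) {v : V} {S : List V} (hv : v ∉ S) :
    1 - occ G p v S = qBreve G (v :: S).toFinset p / qBreve G S.toFinset p := by
  have h := hp.2 S.toFinset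
  rw [List.toFinset_cons, qBreve_insert (by simpa using hv), occ]
  field_simp

theorem occ_nonneg {p : V → ℝ} (hp : Positive G p) (v : V) (S : List V) : 0 ≤ occ G p v S :=
  mul_nonneg (hp.1 v) (div_nonneg (hp.2 _).le (hp.2 _).le)

theorem occ_lt_one {p : V → ℝ} (hp : Positive G p) (v : V) (S : List V) (hv : v ∉ S) :
    occ G p v S < 1 := by
  have := div_pos (hp.2 (v :: S).toFinset) (hp.2 S.toFinset)
  rw [← one_sub_occ hp hv] at this
  linarith

/-- Each factor `1 - occ G p u R` is a quotient of polynomials of consecutive vertex sets, so the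
product telescopes. -/
theorem foldRatio_occ {p : V → ℝ} (hp : Positive G p) (N R : List V) (h : (N ++ R).Nodup) :
    foldRatio (occ G p) N R = qBreve G R.toFinset p / qBreve G (N ++ R).toFinset p := by
  induction N generalizing R with
  | nil => simp [foldRatio, (hp.2 R.toFinset).ne']
  | cons u N ih =>
    have h' : (N ++ u :: R).Nodup := by rwa [List.nodup_middle]
    have h2 := List.nodup_cons.1 h'.of_append_right
    have e : (N ++ u :: R).toFinset = (u :: N ++ R).toFinset := by
      ext; simp
    rw [foldRatio, ih _ h', one_sub_occ hp h2.1, e]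
    have h3 := (hp.2 (u :: R).toFinset).ne'
    have h4 := (hp.2 R.toFinset).ne'
    have h5 := (hp.2 (u :: N ++ R).toFinset).ne'
    field_simp

theorem foldRatio_occ_filter {p : V → ℝ} (hp : Positive G p) {S : List V} (hS : S.Nodup)
    (P : V → Prop) [DecidablePred P] :
    foldRatio (occ G p) (S.filter fun u => P u) (S.filter fun u => ¬ P u) =
      qBreve G (S.toFinset.filter fun u => ¬ P u) p / qBreve G S.toFinset p := by
  rw [foldRatio_occ hp _ _ (nodup_filter_append hS P)]
  congr 2
  · ext; simp
  · ext x; by_cases h : P x <;> simp [h]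

/-- The exact recursion that `approxRatio` truncates. Since `v ∉ S`, the value of `adj` on the
diagonal is irrelevant, which leaves room for a reflexive `adj`. -/
theorem occ_eq_mul_foldRatio {p : V → ℝ} (hp : Positive G p) {S : List V} (hS : S.Nodup) {v : V}
    (hv : v ∉ S) {adj : V → V → Prop} [DecidableRel adj]
    (hadj : ∀ u v, u ≠ v → (adj u v ↔ G.Adj u v)) :
    occ G p v S = p v * foldRatio (occ G p) (S.filter fun u => adj v u)
      (S.filter fun u => ¬ adj v u) := by
  rw [foldRatio_occ_filter hp hS, occ]
  congr 3
  ext u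
  simp only [Finset.mem_filter, List.mem_toFinset, and_congr_right_iff, not_iff_not]
  exact fun hu => (hadj v u (fun e => hv (e ▸ hu))).symm

/-- The prefactor `p v` gains the factor `s`, and the product is monotone in its entries, whose
lists are shorter. This turns slack in `p` into distance from the singularity of `negLog` at 1. -/
theorem occ_mul_le [Fintype V] {p : V → ℝ} {s : ℝ} (hs : 1 ≤ s) (hp : Positive G p)
    (hp' : Positive G (s • p)) (k : ℕ) (v : V) (S : List V) (hv : v ∉ S) (hS : S.Nodup)
    (hk : S.length < k) : s * occ G p v S ≤ occ G (s • p) v S := by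
  classical
  induction k generalizing v S with
  | zero => simp at hk
  | succ k ih =>
    rw [occ_eq_mul_foldRatio hp hS hv (adj := G.Adj) (fun _ _ _ => Iff.rfl),
      occ_eq_mul_foldRatio hp' hS hv (adj := G.Adj) (fun _ _ _ => Iff.rfl)]
    rw [Pi.smul_apply, smul_eq_mul, ← mul_assoc]
    refine mul_le_mul_of_nonneg_left ?_ (mul_nonneg (by linarith) (hp.1 v))
    refine foldRatio_mono k _ _ (nodup_filter_append hS _) ?_ (fun u T hu hT hTk => ?_)
      (fun u T hu _ => occ_lt_one hp' u T hu)
    · have := S.length_eq_length_filter_add (fun u => decide (G.Adj v u))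
      simp only [decide_not]
      omega
    · exact (le_mul_of_one_le_left (occ_nonneg hp u T) hs).trans (ih u T hu hT hTk)

/-- The error of the truncated recursion decays exponentially with the depth. -/
theorem approxRatio_error [Fintype V] {p : V → ℝ} {δ θ : ℝ} (hδ : 0 < δ)
    (hp' : Positive G ((1 + δ) • p)) (hp : Positive G p) {adj : V → V → Prop} [DecidableRel adj]
    (hadj : ∀ u v, u ≠ v → (adj u v ↔ G.Adj u v)) (hθ1 : θ ≤ 1 / 2)
    (hθδ : θ ^ 2 ≤ Real.log (1 + δ)) (l : ℕ) (v : V) (S : List V) (hv : v ∉ S) (hS : S.Nodup) :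
    (0 ≤ p v * approxRatio adj p l v S ∧ p v * approxRatio adj p l v S ≤ occ G p v S) ∧
    negLog (occ G p v S) - negLog (p v * approxRatio adj p l v S) ≤
      (1 / δ * (1 - θ) ^ l) * (negLog (occ G ((1 + δ) • p) v S) - negLog (occ G p v S)) := by
  induction l generalizing v S with
  | zero =>
    have hx0 := occ_nonneg hp v S
    have hx1 := occ_lt_one hp v S hv
    have hy1 := occ_lt_one hp' v S hv
    have hxy := occ_mul_le (by linarith) hp hp' _ v S hv hS (Nat.lt_succ_self _)
    set x := occ G p v S
    set y := occ G ((1 + δ) • p) v S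
    refine ⟨by simpa [approxRatio] using hx0, ?_⟩
    simp only [approxRatio, mul_zero, pow_zero, mul_one]
    have h1 := negLog_sub_le hx1 (zero_lt_one' ℝ)
    have h2 := negLog_sub_le (x := x) (y := y) hx1 hy1
    have hx' : 0 < 1 - x := by linarith
    have h3 : δ * (x / (1 - x)) ≤ (y - x) / (1 - x) := by
      rw [← mul_div_assoc]
      exact div_le_div_of_nonneg_right (by linarith) hx'.le
    have h4 : (x - y) / (1 - x) = - ((y - x) / (1 - x)) := by ring
    rw [div_mul_eq_mul_div, one_mul, le_div_iff₀ hδ]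
    rw [sub_zero] at h1
    have := mul_le_mul_of_nonneg_right h1 hδ.le
    linarith
  | succ l ih =>
    have hX1 : ∀ u T, u ∉ T → T.Nodup → occ G p u T < 1 := fun u T hu _ => occ_lt_one hp u T hu
    have hY1 : ∀ u T, u ∉ T → T.Nodup → occ G ((1 + δ) • p) u T < 1 :=
      fun u T hu _ => occ_lt_one hp' u T hu
    have hA1 : ∀ u T, u ∉ T → T.Nodup → p u * approxRatio adj p l u T < 1 := fun u T hu hT =>
      lt_of_le_of_lt (ih u T hu hT).1.2 (hX1 u T hu hT)
    have hxy := occ_mul_le (by linarith) hp hp' _ v S hv hS (Nat.lt_succ_self _)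
    have hy1 := hY1 v S hv hS
    have hx0 := occ_nonneg hp v S
    have hnd := nodup_filter_append hS (adj v)
    have hcmp := log_foldRatio_compare _ _ hnd hX1 hA1 hY1 fun u T hu hT => (ih u T hu hT).2
    have hmonoA : foldRatio (fun u T => p u * approxRatio adj p l u T)
        (S.filter fun u => adj v u) (S.filter fun u => ¬ adj v u) ≤ foldRatio (occ G p)
        (S.filter fun u => adj v u) (S.filter fun u => ¬ adj v u) :=
      foldRatio_mono _ _ _ hnd le_rfl (fun u T hu hT _ => (ih u T hu hT).1.2) hX1
    have hmonoY : foldRatio (occ G p)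
        (S.filter fun u => adj v u) (S.filter fun u => ¬ adj v u) ≤
        foldRatio (occ G ((1 + δ) • p))
        (S.filter fun u => adj v u) (S.filter fun u => ¬ adj v u) :=
      foldRatio_mono _ _ _ hnd le_rfl (fun u T hu hT _ =>
        (le_mul_of_one_le_left (occ_nonneg hp u T) (by linarith)).trans
          (occ_mul_le (by linarith) hp hp' _ u T hu hT (Nat.lt_succ_self _))) hY1
    have hposA := foldRatio_pos _ _ hnd hA1
    have hposX := foldRatio_pos _ _ hnd hX1
    have hposY := foldRatio_pos _ _ hnd hY1
    rw [occ_eq_mul_foldRatio hp hS hv hadj] at hx0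
    rw [occ_eq_mul_foldRatio hp' hS hv hadj] at hy1
    rw [occ_eq_mul_foldRatio hp hS hv hadj, occ_eq_mul_foldRatio hp' hS hv hadj, approxRatio]
    set fA := foldRatio (fun u T => p u * approxRatio adj p l u T)
        (S.filter fun u => adj v u) (S.filter fun u => ¬ adj v u)
    set fX := foldRatio (occ G p) (S.filter fun u => adj v u) (S.filter fun u => ¬ adj v u)
    set fY := foldRatio (occ G ((1 + δ) • p))
        (S.filter fun u => adj v u) (S.filter fun u => ¬ adj v u)
    have hβ : 0 ≤ Real.log (1 + δ) := Real.log_nonneg (by linarith)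
    have ea : p v * fA = p v * fX * Real.exp (-(Real.log fX - Real.log fA)) := by
      rw [neg_sub, Real.exp_sub, Real.exp_log hposA, Real.exp_log hposX]
      field_simp
    -- Besides the growth of the product, the slack contributes `log (1 + δ)`: this is the surplus
    -- `β` in `contraction`.
    have eT : ((1 + δ) • p) v * fY =
        p v * fX * Real.exp (Real.log (1 + δ) + (Real.log fY - Real.log fX)) := by
      rw [Real.exp_add, Real.exp_sub, Real.exp_log hposY, Real.exp_log hposX,
        Real.exp_log (by linarith), Pi.smul_apply, smul_eq_mul]
      field_simp
    refine ⟨⟨mul_nonneg (hp.1 v) hposA.le, mul_le_mul_of_nonneg_left hmonoA (hp.1 v)⟩, ?_⟩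
    rw [pow_succ, ← mul_assoc, ea, eT]
    rw [eT] at hy1
    have hlogXY := Real.log_le_log hposX hmonoY
    refine contraction (β := Real.log (1 + δ)) hx0 hy1 ?_ hβ (by linarith) ?_ hθ1 hθδ ?_
    · exact sub_nonneg.2 (Real.log_le_log hposA hmonoA)
    · simpa using hcmp
    · exact mul_nonneg (by positivity) (pow_nonneg (by linarith) _)

/-- The truncated recursion approximates the ratio for the closed neighbourhood of a vertex. -/
theorem approxRatio_closedNeighbour [Fintype V] {p : V → ℝ} {δ θ : ℝ} (hδ : 0 < δ)
    (hp'' : Positive G ((1 + δ) • (1 + δ) • p)) (hp' : Positive G ((1 + δ) • p))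
    (hp : Positive G p) {adj : V → V → Prop}
    [DecidableRel adj] (hadj : ∀ u v, u ≠ v → (adj u v ↔ G.Adj u v))
    (hθ1 : θ ≤ 1 / 2) (hθδ : θ ^ 2 ≤ Real.log (1 + δ)) (l : ℕ) (v : V) (S : List V)
    (hS : S.Nodup) :
    0 < approxRatio adj p (l + 1) v S ∧
    approxRatio adj p (l + 1) v S ≤
      qBreve G (S.toFinset.filter fun u => ¬ adj v u) p / qBreve G S.toFinset p ∧
    qBreve G (S.toFinset.filter fun u => ¬ adj v u) p / qBreve G S.toFinset p ≤
      Real.exp (S.length * (1 / δ * (1 - θ) ^ l * (2 / δ))) *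
        approxRatio adj p (l + 1) v S := by
  have herr := approxRatio_error hδ hp' hp hadj hθ1 hθδ l
  have hX1 : ∀ u T, u ∉ T → T.Nodup → occ G p u T < 1 := fun u T hu _ => occ_lt_one hp u T hu
  have hA1 : ∀ u T, u ∉ T → T.Nodup → p u * approxRatio adj p l u T < 1 := fun u T hu hT =>
    lt_of_le_of_lt (herr u T hu hT).1.2 (hX1 u T hu hT)
  have hnd := nodup_filter_append hS (adj v)
  rw [← foldRatio_occ_filter hp hS (adj v), approxRatio]
  have hposA := foldRatio_pos _ _ hnd hA1
  have hposX := foldRatio_pos _ _ hnd hX1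
  have hc : 0 ≤ 1 / δ * (1 - θ) ^ l := mul_nonneg (by positivity) (pow_nonneg (by linarith) _)
  refine ⟨hposA, foldRatio_mono _ _ _ hnd le_rfl (fun u T hu hT _ => (herr u T hu hT).1.2) hX1, ?_⟩
  have hB := log_foldRatio_le (B := 1 / δ * (1 - θ) ^ l * (2 / δ)) _ _ hnd hX1 hA1
    (fun u T hu hT => (herr u T hu hT).2.trans (by
      refine mul_le_mul_of_nonneg_left ?_ hc
      -- The second factor `1 + δ` of slack keeps the occupation at `(1 + δ) • p` below `1 / (1 +
      -- δ)`, so its `negLog` is bounded.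
      have hy := occ_mul_le (by linarith) hp' hp'' _ u T hu hT (Nat.lt_succ_self _)
      have hy0 := occ_nonneg hp' u T
      have hy1 := occ_lt_one hp' u T hu
      have hy2 := occ_lt_one hp'' u T hu
      have hx0 := negLog_nonneg (occ_nonneg hp u T) (hX1 u T hu hT)
      have h1 := negLog_sub_le hy1 (zero_lt_one' ℝ)
      have h2 : (occ G ((1 + δ) • p) u T - 0) / (1 - occ G ((1 + δ) • p) u T) ≤ 2 / δ := by
        rw [div_le_div_iff₀ (by linarith) hδ]
        nlinarith
      have h3 : negLog 0 = 0 := by simp [negLog]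
      linarith))
  have hlen : (S.filter fun u => adj v u).length ≤ S.length := List.length_filter_le _ _
  have h4 : ((S.filter fun u => adj v u).length : ℝ) * (1 / δ * (1 - θ) ^ l * (2 / δ)) ≤
      S.length * (1 / δ * (1 - θ) ^ l * (2 / δ)) :=
    mul_le_mul_of_nonneg_right (by exact_mod_cast hlen) (mul_nonneg hc (by positivity))
  rw [← Real.log_le_log_iff hposX (by positivity), Real.log_mul (Real.exp_pos _).ne' hposA.ne',
    Real.log_exp]
  linarith

/-- Bound for the normalized probability of occurrence in the hard core model. -/
theorem mul_ratio_le {p : V → ℝ} [Fintype V] {δ : ℝ} (hδ : 0 < δ)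
    (hp' : Positive G ((1 + δ) • p)) (hp : Positive G p) {v : V} {U : Finset V} (hv : v ∈ U)
    [DecidablePred fun u => u ≠ v ∧ ¬ G.Adj v u] :
    p v * (qBreve G (U.filter fun u => u ≠ v ∧ ¬ G.Adj v u) p / qBreve G U p) ≤ 2 / δ := by
  classical
  obtain ⟨S, hS⟩ : ∃ S : List V, S = (U.erase v).toList := ⟨_, rfl⟩
  have hvS : v ∉ S := by simp [hS]
  have hnd : S.Nodup := hS ▸ Finset.nodup_toList _
  have hx := occ_lt_one hp v S hvS
  have hy := occ_lt_one hp' v S hvS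
  have hxy := occ_mul_le (by linarith) hp hp' _ v S hvS hnd (Nat.lt_succ_self _)
  have e1 := one_sub_occ hp hvS
  have eS : S.toFinset = U.erase v := by simp [hS]
  have eU : (v :: S).toFinset = U := by simp [eS, Finset.insert_erase hv]
  have eF : (S.toFinset.filter fun u => ¬ G.Adj v u) =
      U.filter fun u => u ≠ v ∧ ¬ G.Adj v u := by
    ext u; simp [eS]; tauto
  have hU := hp.2 U
  have hS' := hp.2 S.toFinset
  have e2 : p v * (qBreve G (U.filter fun u => u ≠ v ∧ ¬ G.Adj v u) p / qBreve G U p) =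
      occ G p v S / (1 - occ G p v S) := by
    rw [e1, eU, occ, ← eF]
    have h1 := hU.ne'
    have h2 := hS'.ne'
    field_simp
  -- The slack gives `(1 + δ) * x < 1` for `x = occ G p v S`, so `x / (1 - x)` is below `1 / δ`.
  rw [e2, div_le_div_iff₀ (by linarith) hδ]
  nlinarith

end Decay

/-! ### Probabilities of the events and rounding of one variable -/

section Rounding

variable {n m : ℕ} (M : VariableModel n m)

/-- The events `j` and `k` share a variable. -/
def VariableModel.Meets (j k : Fin n) : Prop := (M.vars j ∩ M.vars k).Nonempty

instance : DecidableRel M.Meets := fun j k =>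
  inferInstanceAs (Decidable (M.vars j ∩ M.vars k).Nonempty)

theorem VariableModel.meets_iff_adj (j k : Fin n) (h : j ≠ k) :
    M.Meets j k ↔ M.depGraph.Adj j k := by
  simp [VariableModel.Meets, VariableModel.depGraph, h]

theorem productWeight_update (z : Fin m → ℝ) (i : Fin m) (x : ℝ) (ω : Fin m → Bool) :
    productWeight (Function.update z i x) ω = (if ω i then x else 1 - x) *
      ∏ k ∈ Finset.univ.erase i, if ω k then z k else 1 - z k := by
  rw [productWeight, ← Finset.mul_prod_erase _ _ (Finset.mem_univ i), Function.update_self]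
  congr 1
  refine Finset.prod_congr rfl fun k hk => ?_
  rw [Function.update_of_ne (Finset.ne_of_mem_erase hk)]

theorem VariableModel.prob_update (z : Fin m → ℝ) (i : Fin m) (x : ℝ) (j : Fin n) :
    M.prob (Function.update z i x) j = (1 - x) * M.prob (Function.update z i 0) j +
      x * M.prob (Function.update z i 1) j := by
  simp only [VariableModel.prob, productWeight_update, Finset.mul_sum, ← Finset.sum_add_distrib]
  refine Finset.sum_congr rfl fun ω _ => ?_
  split_ifs <;> ring

theorem VariableModel.prob_eq (z : Fin m → ℝ) (i : Fin m) (j : Fin n) :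
    M.prob z j = (1 - z i) * M.prob (Function.update z i 0) j +
      z i * M.prob (Function.update z i 1) j := by
  rw [← M.prob_update, Function.update_eq_self]

/-- Flipping the coordinate `i` is an involution that preserves the event and exchanges the two
weights. -/
theorem VariableModel.prob_update_of_notMem (z : Fin m → ℝ) {i : Fin m} {j : Fin n}
    (hi : i ∉ M.vars j) :
    M.prob (Function.update z i 0) j = M.prob (Function.update z i 1) j := by
  classical
  simp only [VariableModel.prob, productWeight_update]
  have hinv : ∀ ω : Fin m → Bool, Function.update (Function.update ω i (!ω i)) i
      (!(Function.update ω i (!ω i)) i) = ω := fun ω => by simp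
  have hmem : ∀ ω ∈ Finset.univ.filter (fun ω => ω ∈ M.event j),
      Function.update ω i (!ω i) ∈ Finset.univ.filter (fun ω => ω ∈ M.event j) := by
    intro ω hω
    rw [Finset.mem_filter] at hω ⊢
    refine ⟨Finset.mem_univ _, (M.event_congr j _ _ fun k hk => ?_).1 hω.2⟩
    have hki : k ≠ i := by rintro rfl; exact hi hk
    rw [Function.update_of_ne hki]
  refine Finset.sum_nbij' (fun ω => Function.update ω i (!ω i))
    (fun ω => Function.update ω i (!ω i)) hmem hmem (fun ω _ => hinv ω) (fun ω _ => hinv ω) ?_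
  intro ω _
  congr 1
  · cases h : ω i <;> simp
  · refine Finset.prod_congr rfl fun k hk => ?_
    rw [Function.update_of_ne (Finset.ne_of_mem_erase hk)]

theorem VariableModel.prob_update_eq_of_notMem (z : Fin m → ℝ) {i : Fin m} {j : Fin n}
    (hi : i ∉ M.vars j) (x : ℝ) : M.prob (Function.update z i x) j = M.prob z j := by
  rw [M.prob_update, M.prob_eq z i, M.prob_update_of_notMem z hi]
  ring

theorem productWeight_nonneg {z : Fin m → ℝ} (hz : ∀ i, 0 ≤ z i ∧ z i ≤ 1) (ω : Fin m → Bool) :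
    0 ≤ productWeight z ω := by
  refine Finset.prod_nonneg fun i _ => ?_
  split_ifs
  exacts [(hz i).1, sub_nonneg.2 (hz i).2]

theorem VariableModel.prob_nonneg {z : Fin m → ℝ} (hz : ∀ i, 0 ≤ z i ∧ z i ≤ 1) (j : Fin n) :
    0 ≤ M.prob z j :=
  Finset.sum_nonneg fun ω _ => productWeight_nonneg hz ω

/-- If the probabilities at a vertex of the cube are below one, the vertex avoids the events. -/
theorem VariableModel.notMem_event {ω : Fin m → Bool} {j : Fin n}
    (h : M.prob (fun i => if ω i then 1 else 0) j < 1) : ω ∉ M.event j := by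
  classical
  intro hω
  refine absurd h (not_lt.2 ?_)
  have hz : ∀ i, (0 : ℝ) ≤ (if ω i then 1 else 0) ∧ (if ω i then (1 : ℝ) else 0) ≤ 1 := fun i => by
    split_ifs <;> norm_num
  have h1 : productWeight (fun i => if ω i then (1 : ℝ) else 0) ω = 1 := by
    refine Finset.prod_eq_one fun i _ => ?_
    cases h : ω i <;> simp [h]
  refine h1.symm.le.trans ?_
  exact Finset.single_le_sum (f := productWeight fun i => if ω i then (1 : ℝ) else 0)
    (fun ω _ => productWeight_nonneg hz ω) (Finset.mem_filter.2 ⟨Finset.mem_univ _, hω⟩)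

theorem update_mem_unit {z : Fin m → ℝ} (hz : ∀ i, 0 ≤ z i ∧ z i ≤ 1) (i : Fin m) {x : ℝ}
    (h0 : 0 ≤ x) (h1 : x ≤ 1) (k : Fin m) :
    0 ≤ Function.update z i x k ∧ Function.update z i x k ≤ 1 := by
  by_cases h : k = i
  · subst h; simp [h0, h1]
  · simp [Function.update_of_ne h, hz k]

theorem Positive.of_smul {V : Type*} [Fintype V] {G : SimpleGraph V} {p : V → ℝ}
    (hp : ∀ v, 0 ≤ p v) {s t : ℝ} (hs : Positive G (s • p)) (ht : 0 ≤ t) (hts : t ≤ s) :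
    Positive G (t • p) := by
  classical
  exact hs.mono (fun v => mul_nonneg ht (hp v)) fun v => mul_le_mul_of_nonneg_right hts (hp v)

/-- Rounding the variable `i` according to the approximate derivative preserves positivity, at the
price of a factor `(1 + δ) ^ 2`. -/
theorem VariableModel.positive_update (hn : 0 < n) {z : Fin m → ℝ} (hz : ∀ i, 0 ≤ z i ∧ z i ≤ 1)
    {t δ θ : ℝ} (ht : 0 < t) (hδ : 0 < δ) (hδ1 : δ ≤ 1) (hθ1 : θ ≤ 1 / 2)
    (hθδ : θ ^ 2 ≤ Real.log (1 + δ)) {l : ℕ} (hl : 8 * (n : ℝ) ^ 2 * (1 - θ) ^ l < δ ^ 3)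
    (hP : Positive M.depGraph (((1 + δ) * (1 + δ) * t) • M.prob z)) (i : Fin m) {b : Bool}
    (hb : b = true ↔ ∑ j, (M.prob (Function.update z i 1) j - M.prob (Function.update z i 0) j) *
      approxRatio M.Meets (t • M.prob z) (l + 1) j (List.finRange n) ≤ 0) :
    Positive M.depGraph (t • M.prob (Function.update z i (if b then 1 else 0))) := by
  classical
  have hp0 := M.prob_nonneg hz
  have hP2 : Positive M.depGraph ((1 + δ) • (1 + δ) • t • M.prob z) := by
    simpa only [smul_smul, mul_assoc] using hP
  have hP1 : Positive M.depGraph ((1 + δ) • t • M.prob z) := by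
    rw [smul_smul]
    exact hP.of_smul hp0 (by positivity) (by nlinarith [mul_pos hδ ht])
  have hP0 : Positive M.depGraph (t • M.prob z) :=
    hP.of_smul hp0 ht.le (by nlinarith [mul_pos hδ ht, mul_pos hδ (mul_pos hδ ht)])
  set p := t • M.prob z with hp
  set zb := Function.update z i (if b then (1 : ℝ) else 0) with hzb
  have hzb01 : ∀ k, 0 ≤ zb k ∧ zb k ≤ 1 :=
    update_mem_unit hz i (by split_ifs <;> norm_num) (by split_ifs <;> norm_num)
  set C : Finset (Fin n) := Finset.univ.filter fun j => i ∈ M.vars j with hCdef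
  have hmemC : ∀ {j}, j ∈ C ↔ i ∈ M.vars j := by simp [hCdef]
  have hC : M.depGraph.IsClique (C : Set (Fin n)) := fun j hj k hk hjk =>
    ⟨hjk, i, Finset.mem_inter.2 ⟨hmemC.1 hj, hmemC.1 hk⟩⟩
  have hoff : ∀ j, j ∉ C → (t • M.prob zb) j = p j := fun j hj => by
    simp only [hp, hzb, Pi.smul_apply]
    rw [M.prob_update_eq_of_notMem z (fun h => hj (hmemC.2 h))]
  refine hP0.of_clique hC hoff (fun j => mul_nonneg ht.le (M.prob_nonneg hzb01 j)) ?_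
  rw [qBreve_clique_sub hC _ hoff, Finset.univ_inter]
  set W : Fin n → ℝ := fun j => approxRatio M.Meets p (l + 1) j (List.finRange n) with hW
  set w : Fin n → ℝ := fun j => qBreve M.depGraph
    (Finset.univ.filter fun u => u ≠ j ∧ ¬ M.depGraph.Adj j u) p / qBreve M.depGraph Finset.univ p
    with hw
  -- `ε` bounds the logarithmic error of every approximate weight `W j`.
  set ε : ℝ := n * (1 / δ * (1 - θ) ^ l * (2 / δ)) with hε
  have hθp : 0 ≤ (1 - θ) ^ l := pow_nonneg (by linarith) l
  have hε0 : 0 ≤ ε := by positivity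
  have hq := hP0.2 Finset.univ
  have happ : ∀ j ∈ C, 0 < W j ∧ W j ≤ w j ∧ w j ≤ Real.exp ε * W j := by
    intro j hj
    have h := approxRatio_closedNeighbour hδ hP2 hP1 hP0 M.meets_iff_adj hθ1 hθδ l j
      (List.finRange n) (List.nodup_finRange n)
    -- `Meets` is reflexive at `j` because `i ∈ M.vars j`, so the filter removes the closed
    -- neighbourhood.
    have e : ((List.finRange n).toFinset.filter fun u => ¬ M.Meets j u) =
        Finset.univ.filter fun u => u ≠ j ∧ ¬ M.depGraph.Adj j u := by
      ext u
      simp only [Finset.mem_filter, List.mem_toFinset, List.mem_finRange, Finset.mem_univ,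
        true_and]
      constructor
      · intro hu
        have hne : u ≠ j := by
          rintro rfl
          exact hu ⟨i, by simpa using hmemC.1 hj⟩
        exact ⟨hne, fun ha => hu ((M.meets_iff_adj j u hne.symm).2 ha)⟩
      · exact fun hu ha => hu.2 ((M.meets_iff_adj j u hu.1.symm).1 ha)
    rw [e, List.toFinset_finRange, List.length_finRange] at h
    exact h
  have hpb0 : ∀ j, 0 ≤ (t • M.prob zb) j := fun j => mul_nonneg ht.le (M.prob_nonneg hzb01 j)
  have hpw : ∀ j ∈ C, p j * w j ≤ 2 / δ := fun j _ =>
    mul_ratio_le hδ hP1 hP0 (Finset.mem_univ j)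
  -- `∑ p_j W_j` is affine in `z i` with fixed weights, and `b` is the endpoint chosen by the sign
  -- of its slope.
  have hmin : ∑ j ∈ C, (t • M.prob zb) j * W j ≤ ∑ j ∈ C, p j * W j := by
    have hsumC : ∑ j ∈ C, (M.prob (Function.update z i 1) j - M.prob (Function.update z i 0) j) *
        W j = ∑ j, (M.prob (Function.update z i 1) j - M.prob (Function.update z i 0) j) *
        W j := by
      refine Finset.sum_subset (Finset.subset_univ _) fun j _ hj => ?_
      rw [M.prob_update_of_notMem z (fun h => hj (hmemC.2 h)), sub_self, zero_mul]
    rw [← hsumC] at hb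
    set D := ∑ j ∈ C, (M.prob (Function.update z i 1) j - M.prob (Function.update z i 0) j) * W j
      with hD
    have hdiff : ∑ j ∈ C, (t • M.prob zb) j * W j - ∑ j ∈ C, p j * W j =
        t * ((if b then (1 : ℝ) else 0) - z i) * D := by
      rw [hD, Finset.mul_sum, ← Finset.sum_sub_distrib]
      refine Finset.sum_congr rfl fun j _ => ?_
      simp only [hp, Pi.smul_apply, smul_eq_mul, hzb]
      rw [M.prob_update z i, M.prob_eq z i j]
      ring
    rw [← sub_nonpos, hdiff]
    cases b with
    | true =>
      have hD0 : D ≤ 0 := hb.1 rfl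
      have := mul_nonneg ht.le (sub_nonneg.2 (hz i).2)
      simp only [if_true]
      nlinarith
    | false =>
      have hD0 : 0 ≤ D := by
        by_contra h
        exact absurd (hb.2 (not_le.1 h).le) (by simp)
      have := mul_nonneg ht.le (hz i).1
      simp only [Bool.false_eq_true, if_false]
      nlinarith
  -- Passing from `w` to `W` and back costs only one factor `exp ε`, since `W ≤ w`.
  have h1 : ∑ j ∈ C, (t • M.prob zb) j * w j ≤ Real.exp ε * ∑ j ∈ C, p j * w j := by
    calc ∑ j ∈ C, (t • M.prob zb) j * w j ≤ ∑ j ∈ C, Real.exp ε * ((t • M.prob zb) j * W j) := by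
          refine Finset.sum_le_sum fun j hj => ?_
          have := mul_le_mul_of_nonneg_left (happ j hj).2.2 (hpb0 j)
          linarith
      _ = Real.exp ε * ∑ j ∈ C, (t • M.prob zb) j * W j := (Finset.mul_sum ..).symm
      _ ≤ Real.exp ε * ∑ j ∈ C, p j * W j := mul_le_mul_of_nonneg_left hmin (Real.exp_pos _).le
      _ ≤ _ := mul_le_mul_of_nonneg_left (Finset.sum_le_sum fun j hj =>
          mul_le_mul_of_nonneg_left (happ j hj).2.1 (hP0.1 j)) (Real.exp_pos _).le
  have hX : ∑ j ∈ C, p j * w j ≤ n * (2 / δ) := by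
    refine (Finset.sum_le_card_nsmul C _ _ hpw).trans ?_
    rw [nsmul_eq_mul]
    have : (C.card : ℝ) ≤ n := by
      have := Finset.card_le_univ C
      rw [Fintype.card_fin] at this
      exact_mod_cast this
    gcongr
  have hX0 : 0 ≤ ∑ j ∈ C, p j * w j := Finset.sum_nonneg fun j hj =>
    mul_nonneg (hP0.1 j) ((happ j hj).1.le.trans (happ j hj).2.1)
  have hεn : ε * (4 * n) < δ := by
    have e : ε * (4 * n) * δ ^ 2 = 8 * (n : ℝ) ^ 2 * (1 - θ) ^ l := by
      rw [hε]; field_simp; ring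
    have h2 : ε * (4 * n) * δ ^ 2 < δ * δ ^ 2 := by rw [e]; linarith [pow_succ' δ 2]
    exact lt_of_mul_lt_mul_right h2 (by positivity)
  have hn1 : (1 : ℝ) ≤ n := by exact_mod_cast hn
  have hε1 : ε ≤ 1 := by nlinarith
  have hexp : Real.exp ε - 1 ≤ 2 * ε := by
    have := Real.abs_exp_sub_one_le (abs_le.2 ⟨by linarith, hε1⟩)
    rw [abs_of_nonneg hε0] at this
    exact (le_abs_self _).trans this
  -- The weighted sum therefore grows by less than 1, and the polynomial of the whole graph, which
  -- changes by `q` times this growth, stays positive.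
  have hfin : (Real.exp ε - 1) * ∑ j ∈ C, p j * w j < 1 := by
    calc (Real.exp ε - 1) * ∑ j ∈ C, p j * w j ≤ 2 * ε * (n * (2 / δ)) :=
          mul_le_mul hexp hX hX0 (by positivity)
      _ = ε * (4 * n) / δ := by ring
      _ < 1 := by rwa [div_lt_one hδ]
  have hqe : ∀ j, qBreve M.depGraph
      (Finset.univ.filter fun u => u ≠ j ∧ ¬ M.depGraph.Adj j u) p =
      qBreve M.depGraph Finset.univ p * w j := fun j => by
    rw [hw]; field_simp
  have hsum : ∑ j ∈ C, ((t • M.prob zb) j - p j) * qBreve M.depGraph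
      (Finset.univ.filter fun u => u ≠ j ∧ ¬ M.depGraph.Adj j u) p =
      qBreve M.depGraph Finset.univ p *
        (∑ j ∈ C, (t • M.prob zb) j * w j - ∑ j ∈ C, p j * w j) := by
    rw [← Finset.sum_sub_distrib, Finset.mul_sum]
    refine Finset.sum_congr rfl fun j _ => ?_
    rw [hqe]
    ring
  rw [hsum]
  have : ∑ j ∈ C, (t • M.prob zb) j * w j - ∑ j ∈ C, p j * w j < 1 := by linarith
  have := mul_lt_mul_of_pos_left this hq
  linarith

end Rounding

/-! ### The program -/

/-- Allows the given program to run unchanged inside a larger list of functions. -/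
theorem Steps.mono {defs defs' : List Code} {env : List Val} {e : Code} {v : Val} {t : ℕ}
    (hd : ∀ (f : ℕ) (c : Code), defs[f]? = some c → defs'[f]? = some c)
    (h : Steps defs env e v t) :
    Steps defs' env e v t := by
  induction h with
  | var h => exact .var h
  | nil => exact .nil
  | const => exact .const
  | arith _ _ iha ihb => exact .arith iha ihb
  | pair _ _ iha ihb => exact .pair iha ihb
  | fst _ iha => exact .fst iha
  | snd _ iha => exact .snd iha
  | ifLe_yes _ _ h _ iha ihb ihv => exact .ifLe_yes iha ihb h ihv
  | ifLe_no _ _ h _ iha ihb ihv => exact .ifLe_no iha ihb h ihv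
  | ifPair_yes _ _ iha ihv => exact .ifPair_yes iha ihv
  | ifPair_no _ h _ iha ihv => exact .ifPair_no iha h ihv
  | letIn _ _ iha ihv => exact .letIn iha ihv
  | call _ hf _ iha ihv => exact .call iha (hd _ _ hf) ihv

/-- Derivations are written as terms; this inserts the real identities that do not hold by
computation. -/
theorem Steps.numCast {defs : List Code} {env : List Val} {e : Code} {x y : ℝ} {t : ℕ}
    (hxy : x = y) (h : Steps defs env e (.num x) t) : Steps defs env e (.num y) t :=
  hxy ▸ h

namespace Code

/-- Reverses the first list and prepends it to the second. -/
def revAppend (o : ℕ) : Code :=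
  ifPair (fst (var 0))
    (call (o + 1) (pair (snd (fst (var 0))) (pair (fst (fst (var 0))) (snd (var 0)))))
    (snd (var 0))

/-- Tests whether two 0/1 vectors have a common one. -/
def intersects (o : ℕ) : Code :=
  ifPair (fst (var 0))
    (ifLe (arith .add (fst (fst (var 0))) (fst (snd (var 0)))) (const 1)
      (call (o + 2) (pair (snd (fst (var 0))) (snd (snd (var 0)))))
      (const 1))
    (const 0)

/-- Splits a list of events into those that meet a given event and the others. -/
def split (o : ℕ) : Code :=
  ifPair (snd (var 0))
    (letIn (call (o + 3) (pair (fst (var 0)) (snd (snd (var 0)))))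
      (ifLe (call (o + 2) (pair (fst (var 1)) (fst (fst (snd (var 1)))))) (const 0)
        (pair (fst (var 0)) (pair (fst (snd (var 1))) (snd (var 0))))
        (pair (pair (fst (snd (var 1))) (fst (var 0))) (snd (var 0)))))
    (pair nil nil)

/-- Computes `approxRatio`. -/
def ratio (o : ℕ) : Code :=
  ifLe (fst (var 0)) (const 0) (const 0)
    (letIn (call (o + 3) (snd (var 0)))
      (call (o + 5) (pair (arith .sub (fst (var 1)) (const 1)) (var 0))))

/-- Computes `foldRatio` for `approxRatio`. -/
def fold (o : ℕ) : Code :=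
  ifPair (fst (snd (var 0)))
    (arith .div
      (call (o + 5) (pair (fst (var 0)) (pair (snd (fst (snd (var 0))))
        (pair (fst (fst (snd (var 0)))) (snd (snd (var 0)))))))
      (arith .sub (const 1) (arith .mul (snd (fst (fst (snd (var 0)))))
        (call (o + 4)
          (pair (fst (var 0)) (pair (fst (fst (fst (snd (var 0))))) (snd (snd (var 0)))))))))
    (const 1)

/-- Joins the rows of the incidence matrix and the scaled probabilities of the events. -/
def join (o : ℕ) : Code :=
  ifPair (fst (snd (var 0)))
    (pair
      (pair (fst (fst (snd (var 0)))) (arith .mul (fst (var 0)) (fst (snd (snd (var 0))))))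
      (call (o + 6)
        (pair (fst (var 0)) (pair (snd (fst (snd (var 0)))) (snd (snd (snd (var 0))))))))
    nil

/-- Computes the approximate derivative. -/
def derivative (o : ℕ) : Code :=
  ifPair (fst (var 0))
    (arith .add
      (arith .mul
        (arith .sub (fst (snd (fst (snd (var 0))))) (fst (fst (fst (snd (var 0))))))
        (call (o + 4) (pair (fst (snd (snd (var 0))))
          (pair (fst (fst (var 0))) (snd (snd (snd (var 0))))))))
      (call (o + 7) (pair (snd (fst (var 0)))
        (pair (pair (snd (fst (fst (snd (var 0))))) (snd (snd (fst (snd (var 0))))))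
          (snd (snd (var 0)))))))
    (const 0)

/-- The vector of probabilities, with the first coordinate that is not rounded set to `b`. -/
def probAt (o : ℕ) (input : Code) (b : ℚ) : Code :=
  call o (pair (snd (snd (snd (snd input))))
    (call (o + 1) (pair (snd (fst (fst input))) (pair (const b) (snd (fst input))))))

/-- Rounds the coordinates one by one. -/
def roundAll (o : ℕ) : Code :=
  ifPair (fst (fst (var 0)))
    (letIn (arith .sub (fst (snd (var 0))) (fst (snd (snd (var 0)))))
      (letIn (call (o + 6) (pair (var 0) (pair (fst (snd (snd (snd (snd (var 1))))))
          (call o (pair (snd (snd (snd (snd (var 1))))) (call (o + 1) (fst (var 1))))))))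
        (ifLe
          (call (o + 7) (pair (fst (snd (snd (snd (snd (var 2))))))
            (pair (pair (probAt o (var 2) 0) (probAt o (var 2) 1))
              (pair (fst (snd (snd (snd (var 2))))) (var 0)))))
          (const 0)
          (call (o + 8) (pair
            (pair (snd (fst (fst (var 2)))) (pair (const 1) (snd (fst (var 2)))))
            (pair (var 1) (snd (snd (var 2))))))
          (call (o + 8) (pair
            (pair (snd (fst (fst (var 2)))) (pair (const 0) (snd (fst (var 2)))))
            (pair (var 1) (snd (snd (var 2)))))))))
    (snd (fst (var 0)))

/-- The length of a list. -/
def length (o : ℕ) : Code :=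
  ifPair (var 0) (arith .add (call (o + 9) (snd (var 0))) (const 1)) (const 0)

/-- Searches for an upper bound of the square root. -/
def sqrtSearch (o : ℕ) : Code :=
  ifLe (fst (var 0)) (arith .mul (snd (var 0)) (snd (var 0))) (snd (var 0))
    (call (o + 10) (pair (fst (var 0)) (arith .add (snd (var 0)) (const 1))))

/-- Searches for an upper bound of the binary logarithm. -/
def logSearch (o : ℕ) : Code :=
  ifLe (fst (var 0)) (fst (snd (var 0))) (snd (snd (var 0)))
    (call (o + 11) (pair (fst (var 0))
      (pair (arith .add (fst (snd (var 0))) (fst (snd (var 0))))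
        (arith .add (snd (snd (var 0))) (const 1)))))

/-- The main expression. -/
def main (o : ℕ) : Code :=
  letIn (call (o + 9) (fst (fst (var 0))))
    (letIn (call (o + 9) (fst (snd (var 1))))
      (letIn (arith .div (var 0) (snd (snd (var 2))))
        -- The recursion depth `106 * s * k`, with integers `s ≥ √(m / α)` and `k ≥ log₂ (n m / α)`;
        -- see `depth_suffices`.
        (letIn (arith .mul (arith .mul (const 106) (call (o + 10) (pair (var 0) (const 1))))
            (call (o + 11) (pair (arith .mul (var 2) (var 0)) (pair (const 2) (const 1)))))
          (call (o + 8) (pair (pair (call (o + 1) (pair (fst (snd (var 4))) nil)) nil)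
            (pair (arith .add (const 1) (snd (snd (var 4))))
              (pair (arith .div (snd (snd (var 4))) (var 2)) (pair (var 0) (fst (var 4))))))))))

/-- The functions of the program; `o` is the index of the function for the probabilities. -/
def functions (o : ℕ) : List Code :=
  [revAppend o, intersects o, split o, ratio o, fold o, join o, derivative o, roundAll o,
    length o, sqrtSearch o, logSearch o]

end Code

/-- The program for rounding, which uses the program `Q` for the probabilities. -/
def roundingProgram (Q : Program) : Program where
  defs := Q.defs ++ Q.main :: Code.functions Q.defs.length
  main := Code.main Q.defs.length

/-- The functions are present in `defs`, at the positions that follow `o`. -/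
def HasFunctions (defs : List Code) (o : ℕ) : Prop :=
  ∀ i c, (Code.functions o)[i]? = some c → defs[o + (i + 1)]? = some c

theorem roundingProgram_hasFunctions (Q : Program) :
    HasFunctions (roundingProgram Q).defs Q.defs.length := by
  intro i c h
  -- Position `o` holds `Q.main`, hence the shift by one.
  rw [roundingProgram, List.getElem?_append_right (by omega)]
  simpa using h

/-! ### Correctness and cost of the auxiliary functions -/

section Functions

variable {defs : List Code} {o : ℕ} (hd : HasFunctions defs o)
include hd

theorem revAppend_steps (A B : List Val) :
    ∃ t ≤ 20 * (A.length + 1), Steps defs [.pair (.ofList A) (.ofList B)] (Code.revAppend o)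
      (.ofList (A.reverse ++ B)) t := by
  induction A generalizing B with
  | nil =>
    exact ⟨_, by simp, .ifPair_no (u := .nil) (.fst (.var rfl)) (by simp) (.snd (.var rfl))⟩
  | cons a A ih =>
    obtain ⟨t, ht, h⟩ := ih (a :: B)
    rw [List.reverse_cons, List.append_assoc]
    refine ⟨_, ?_, .ifPair_yes (.fst (.var rfl)) (.call (.pair (.snd (.fst (.var rfl)))
      (.pair (.fst (.fst (.var rfl))) (.snd (.var rfl)))) (hd 0 _ rfl) h)⟩
    simp only [List.length_cons]
    omega

theorem intersects_steps {ι : Type*} (P P' : ι → Prop) [DecidablePred P] [DecidablePred P']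
    (L : List ι) :
    ∃ t ≤ 30 * (L.length + 1), Steps defs
      [.pair (.ofList (L.map fun i => .num (if P i then 1 else 0)))
        (.ofList (L.map fun i => .num (if P' i then 1 else 0)))] (Code.intersects o)
      (.num (if ∃ i ∈ L, P i ∧ P' i then 1 else 0)) t := by
  induction L with
  | nil =>
    refine ⟨_, ?_, .ifPair_no (u := .nil) (.fst (.var rfl)) (by simp) (.numCast (by simp) .const)⟩
    simp
  | cons a L ih =>
    obtain ⟨t, ht, h⟩ := ih
    -- Two 0/1 entries are both one exactly when their sum exceeds 1.
    by_cases ha : P a ∧ P' a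
    · rw [if_pos ⟨a, List.mem_cons_self, ha⟩]
      refine ⟨_, ?_, .ifPair_yes (.fst (.var rfl)) (.ifLe_no (.arith (.fst (.fst (.var rfl)))
        (.fst (.snd (.var rfl)))) .const (by simp [ha.1, ha.2, ArithOp.apply])
        (.numCast (by simp) .const))⟩
      simp only [List.length_cons]
      omega
    · have e : (∃ i ∈ a :: L, P i ∧ P' i) ↔ ∃ i ∈ L, P i ∧ P' i := by simp [ha]
      rw [if_congr e rfl rfl]
      refine ⟨_, ?_, .ifPair_yes (.fst (.var rfl)) (.ifLe_yes (.arith (.fst (.fst (.var rfl)))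
        (.fst (.snd (.var rfl)))) .const ?_ (.call (.pair (.snd (.fst (.var rfl)))
          (.snd (.snd (.var rfl)))) (hd 1 _ rfl) h))⟩
      · simp only [List.length_cons]
        omega
      · by_cases h1 : P a <;> by_cases h2 : P' a <;> simp [h1, h2, ArithOp.apply]
        exact (ha ⟨h1, h2⟩).elim

theorem length_steps (L : List Val) :
    ∃ t ≤ 10 * (L.length + 1), Steps defs [.ofList L] (Code.length o) (.num L.length) t := by
  induction L with
  | nil =>
    refine ⟨_, ?_, .ifPair_no (u := .nil) (.var rfl) (by simp) (.numCast (by simp) .const)⟩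
    simp
  | cons a L ih =>
    obtain ⟨t, ht, h⟩ := ih
    refine ⟨_, ?_, .ifPair_yes (.var rfl)
      (.numCast (by simp [ArithOp.apply]) (.arith (.call (.snd (.var rfl)) (hd 8 _ rfl) h)
        (.const)))⟩
    simp only [List.length_cons]
    omega

/-- Without a rounding operation, an integer bound is found by counting up; `k` is the number of
increments known to suffice. -/
theorem sqrtSearch_steps {T : ℝ} {s : ℕ} (k : ℕ) (hsT : T ≤ ((s + k : ℕ) : ℝ) ^ 2) :
    ∃ s' ≤ s + k, T ≤ (s' : ℝ) ^ 2 ∧ s ≤ s' ∧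
      ∃ t ≤ 20 * (k + 1), Steps defs [.pair (.num T) (.num s)] (Code.sqrtSearch o)
        (.num (s' : ℝ)) t := by
  induction k generalizing s with
  | zero =>
    refine ⟨s, le_rfl, by simpa using hsT, le_rfl, _, ?_, .ifLe_yes (.fst (.var rfl))
      (.arith (.snd (.var rfl)) (.snd (.var rfl))) ?_ (.snd (.var rfl))⟩
    · omega
    · simpa [ArithOp.apply, sq] using hsT
  | succ k ih =>
    by_cases hs : T ≤ (s : ℝ) * s
    · refine ⟨s, by omega, by rwa [sq], le_rfl, _, ?_, .ifLe_yes (.fst (.var rfl))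
        (.arith (.snd (.var rfl)) (.snd (.var rfl))) hs (.snd (.var rfl))⟩
      omega
    · obtain ⟨s', h1, h2, h3, t, ht, h⟩ := ih (s := s + 1) (by rwa [add_right_comm, add_assoc])
      refine ⟨s', by omega, h2, by omega, _, ?_, .ifLe_no (.fst (.var rfl))
        (.arith (.snd (.var rfl)) (.snd (.var rfl))) (not_le.1 hs)
        (.call (.pair (.fst (.var rfl)) (.arith (.snd (.var rfl)) .const)) (hd 9 _ rfl)
          (by simpa [ArithOp.apply] using h))⟩
      omega

theorem logSearch_steps {T : ℝ} {s : ℕ} (k : ℕ) (hsT : T ≤ 2 ^ (s + k)) :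
    ∃ s' ≤ s + k, T ≤ 2 ^ s' ∧ s ≤ s' ∧
      ∃ t ≤ 30 * (k + 1), Steps defs [.pair (.num T) (.pair (.num (2 ^ s)) (.num s))]
        (Code.logSearch o) (.num (s' : ℝ)) t := by
  induction k generalizing s with
  | zero =>
    refine ⟨s, le_rfl, hsT, le_rfl, _, ?_, .ifLe_yes (.fst (.var rfl))
      (.fst (.snd (.var rfl))) hsT (.snd (.snd (.var rfl)))⟩
    omega
  | succ k ih =>
    by_cases hs : T ≤ 2 ^ s
    · refine ⟨s, by omega, hs, le_rfl, _, ?_, .ifLe_yes (.fst (.var rfl))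
        (.fst (.snd (.var rfl))) hs (.snd (.snd (.var rfl)))⟩
      omega
    · obtain ⟨s', h1, h2, h3, t, ht, h⟩ := ih (s := s + 1) (by rwa [add_right_comm, add_assoc])
      refine ⟨s', by omega, h2, by omega, _, ?_, .ifLe_no (.fst (.var rfl))
        (.fst (.snd (.var rfl))) (not_le.1 hs)
        (.call (.pair (.fst (.var rfl)) (.pair (.arith (.fst (.snd (.var rfl)))
          (.fst (.snd (.var rfl)))) (.arith (.snd (.snd (.var rfl))) .const))) (hd 10 _ rfl)
          (by simpa [ArithOp.apply, pow_succ, mul_two] using h))⟩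
      omega

end Functions

/-! ### Correctness and cost of the tree recursion -/

section Recursion

variable {n m : ℕ} (M : VariableModel n m)

/-- A row of the incidence matrix. -/
noncomputable def VariableModel.row (j : Fin n) : Val :=
  encodeVec fun i => if i ∈ M.vars j then (1 : ℝ) else 0

theorem VariableModel.row_eq (j : Fin n) : M.row j = .ofList ((List.finRange m).map fun i =>
    .num (if i ∈ M.vars j then (1 : ℝ) else 0)) := by
  rw [VariableModel.row, encodeVec, List.ofFn_eq_map]

theorem encodeVec_eq {k : ℕ} (x : Fin k → ℝ) :
    encodeVec x = .ofList ((List.finRange k).map fun i => .num (x i)) := by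
  rw [encodeVec, List.ofFn_eq_map]

theorem VariableModel.encodeVars_eq :
    M.encodeVars = .ofList ((List.finRange n).map M.row) := by
  rw [VariableModel.encodeVars, List.ofFn_eq_map]
  rfl

/-- The record of an event in the program: its row and its probability. -/
noncomputable def VariableModel.record (p : Fin n → ℝ) (j : Fin n) : Val :=
  .pair (M.row j) (.num (p j))

/-- A list of records. -/
noncomputable def VariableModel.records (p : Fin n → ℝ) (S : List (Fin n)) : Val :=
  .ofList (S.map (M.record p))

theorem VariableModel.length_filter_meets_le (v : Fin n) {S : List (Fin n)} (hS : S.Nodup) :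
    (S.filter fun u => M.Meets v u).length ≤ M.maxDegree + 1 := by
  classical
  rw [← List.toFinset_card_of_nodup (hS.filter _)]
  have hsub : (S.filter fun u => decide (M.Meets v u)).toFinset ⊆
      insert v (M.depGraph.neighborFinset v) := by
    intro u hu
    rw [List.mem_toFinset, List.mem_filter, decide_eq_true_iff] at hu
    rw [Finset.mem_insert, SimpleGraph.mem_neighborFinset]
    by_cases h : u = v
    · exact Or.inl h
    · exact Or.inr ((M.meets_iff_adj v u (Ne.symm h)).1 hu.2)
  refine (Finset.card_le_card hsub).trans ((Finset.card_insert_le _ _).trans ?_)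
  rw [SimpleGraph.card_neighborFinset_eq_degree]
  refine Nat.succ_le_succ ((M.depGraph.degree_le_maxDegree v).trans (le_of_eq ?_))
  rw [VariableModel.maxDegree]

variable {defs : List Code} {o : ℕ} (hd : HasFunctions defs o) (p : Fin n → ℝ)
include hd

theorem split_steps (v : Fin n) (S : List (Fin n)) :
    ∃ t ≤ 80 * (m + 1) * (S.length + 1), Steps defs [.pair (M.row v) (M.records p S)]
      (Code.split o) (.pair (M.records p (S.filter fun u => M.Meets v u))
        (M.records p (S.filter fun u => ¬ M.Meets v u))) t := by
  induction S with
  | nil =>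
    refine ⟨_, ?_, .ifPair_no (u := .nil) (.snd (.var rfl)) (by simp) (.pair .nil .nil)⟩
    simp only [List.length_nil]
    omega
  | cons a S ih =>
    obtain ⟨t, ht, h⟩ := ih
    obtain ⟨s, hs, h'⟩ := intersects_steps hd (fun i => i ∈ M.vars v) (fun i => i ∈ M.vars a)
      (List.finRange m)
    rw [← M.row_eq, ← M.row_eq] at h'
    have e : (∃ i ∈ List.finRange m, i ∈ M.vars v ∧ i ∈ M.vars a) ↔ M.Meets v a := by
      simp [VariableModel.Meets, Finset.Nonempty]
    simp only [e] at h'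
    rw [List.length_finRange] at hs
    have hb : s + t + 40 ≤ 80 * (m + 1) * ((a :: S).length + 1) := by
      rw [List.length_cons, mul_add _ (S.length + 1) 1]
      linarith
    by_cases ha : M.Meets v a
    · rw [if_pos ha] at h'
      rw [List.filter_cons_of_pos (by simpa using ha), List.filter_cons_of_neg (by simpa using ha)]
      refine ⟨_, ?_, .ifPair_yes (.snd (.var rfl)) (.letIn (.call (.pair (.fst (.var rfl))
        (.snd (.snd (.var rfl)))) (hd 2 _ rfl) h) (.ifLe_no (.call (.pair (.fst (.var rfl))
          (.fst (.fst (.snd (.var rfl))))) (hd 1 _ rfl) h') .const (by simp)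
          (.pair (.pair (.fst (.snd (.var rfl))) (.fst (.var rfl))) (.snd (.var rfl)))))⟩
      omega
    · rw [if_neg ha] at h'
      rw [List.filter_cons_of_neg (by simpa using ha), List.filter_cons_of_pos (by simpa using ha)]
      refine ⟨_, ?_, .ifPair_yes (.snd (.var rfl)) (.letIn (.call (.pair (.fst (.var rfl))
        (.snd (.snd (.var rfl)))) (hd 2 _ rfl) h) (.ifLe_yes (.call (.pair (.fst (.var rfl))
          (.fst (.fst (.snd (.var rfl))))) (hd 1 _ rfl) h') .const (by simp)
          (.pair (.fst (.var rfl)) (.pair (.fst (.snd (.var rfl))) (.snd (.var rfl))))))⟩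
      omega

theorem fold_steps {l T : ℕ} (hT : ∀ v (S : List (Fin n)), S.Nodup → ∃ t ≤ T,
      Steps defs [.pair (.num l) (.pair (M.row v) (M.records p S))] (Code.ratio o)
        (.num (approxRatio M.Meets p l v S)) t) (N R : List (Fin n)) (h : (N ++ R).Nodup) :
    ∃ t ≤ N.length * (T + 50) + 10,
      Steps defs [.pair (.num l) (.pair (M.records p N) (M.records p R))] (Code.fold o)
        (.num (foldRatio (fun u S => p u * approxRatio M.Meets p l u S) N R)) t := by
  induction N generalizing R with
  | nil =>
    refine ⟨_, ?_, .ifPair_no (u := .nil) (.fst (.snd (.var rfl))) (by simp)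
      (.numCast (by simp [foldRatio]) .const)⟩
    simp
  | cons u N ih =>
    have h' : (N ++ u :: R).Nodup := by rwa [List.nodup_middle]
    have h2 := List.nodup_cons.1 h'.of_append_right
    obtain ⟨t, ht, hst⟩ := ih (u :: R) h'
    obtain ⟨s, hs, hss⟩ := hT u R h2.2
    refine ⟨_, ?_, .ifPair_yes (.fst (.snd (.var rfl)))
      (.numCast (by simp [ArithOp.apply, foldRatio]) (.arith (.call (.pair (.fst (.var rfl))
        (.pair (.snd (.fst (.snd (.var rfl)))) (.pair (.fst (.fst (.snd (.var rfl))))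
          (.snd (.snd (.var rfl)))))) (hd 4 _ rfl) hst)
        (.arith .const (.arith
          (.snd (.fst (.fst (.snd (.var rfl)))))
          (.call (.pair (.fst (.var rfl)) (.pair (.fst (.fst (.fst (.snd (.var rfl)))))
            (.snd (.snd (.var rfl))))) (hd 3 _ rfl) hss)))))⟩
    rw [List.length_cons, Nat.succ_mul]
    omega

/-- A call at depth `l + 1` makes at most `d + 1` calls at depth `l`: the degree, and one more
because an event may meet itself. -/
theorem ratio_steps (l : ℕ) (v : Fin n) (S : List (Fin n)) (hS : S.Nodup) :
    ∃ t ≤ 150 * (m + 1) * (n + 1) * (M.maxDegree + 2) ^ l,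
      Steps defs [.pair (.num l) (.pair (M.row v) (M.records p S))] (Code.ratio o)
        (.num (approxRatio M.Meets p l v S)) t := by
  induction l generalizing v S with
  | zero =>
    refine ⟨_, ?_, .ifLe_yes (.fst (.var rfl)) .const (by simp)
      (.numCast (by simp [approxRatio]) .const)⟩
    nlinarith [Nat.zero_le (m * n), Nat.zero_le m, Nat.zero_le n]
  | succ l ih =>
    obtain ⟨s, hs, hss⟩ := split_steps M hd p v S
    obtain ⟨t, ht, hst⟩ := fold_steps M hd p ih _ _ (nodup_filter_append hS (M.Meets v))
    refine ⟨_, ?_, .ifLe_no (.fst (.var rfl)) .const (by push_cast; positivity)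
      (.letIn (.call (.snd (.var rfl)) (hd 2 _ rfl) hss) (.call (.pair (.arith (.fst (.var rfl))
        .const) (.var rfl)) (hd 4 _ rfl) (by simpa [ArithOp.apply, approxRatio] using hst)))⟩
    have hlen : S.length ≤ n := by simpa using hS.length_le_card
    have hN := M.length_filter_meets_le v hS
    have hN' : (S.filter fun u => M.Meets v u).length ≤ n :=
      (List.length_filter_le _ _).trans hlen
    set k := (S.filter fun u => M.Meets v u).length
    set T := 150 * (m + 1) * (n + 1) * (M.maxDegree + 2) ^ l with hTdef
    have hT : 150 * (m + 1) * (n + 1) ≤ T := Nat.le_mul_of_pos_right _ (by positivity)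
    -- The extra `T`, which makes the base `d + 2`, absorbs the cost of splitting and multiplying.
    have e : 150 * (m + 1) * (n + 1) * (M.maxDegree + 2) ^ (l + 1) = (M.maxDegree + 1) * T + T := by
      rw [hTdef]; ring
    have h1 : k * T ≤ (M.maxDegree + 1) * T := Nat.mul_le_mul_right _ hN
    have h2 : 80 * (m + 1) * (S.length + 1) ≤ 80 * (m + 1) * (n + 1) :=
      Nat.mul_le_mul_left _ (by omega)
    rw [e]
    rw [mul_add] at ht
    nlinarith [Nat.zero_le (m * n), Nat.zero_le m, Nat.zero_le n]

theorem join_steps (q : Fin n → ℝ) (s : ℝ) (L : List (Fin n)) :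
    ∃ t ≤ 40 * (L.length + 1), Steps defs
      [.pair (.num s) (.pair (.ofList (L.map M.row)) (.ofList (L.map fun j => .num (q j))))]
      (Code.join o) (M.records (s • q) L) t := by
  induction L with
  | nil =>
    refine ⟨_, ?_, .ifPair_no (u := .nil) (.fst (.snd (.var rfl))) (by simp) .nil⟩
    simp
  | cons a L ih =>
    obtain ⟨t, ht, h⟩ := ih
    refine ⟨_, ?_, .ifPair_yes (.fst (.snd (.var rfl))) (.pair (.pair (.fst (.fst (.snd (.var rfl))))
      (.arith (.fst (.var rfl)) (.fst (.snd (.snd (.var rfl)))))) (.call (.pair (.fst (.var rfl))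
      (.pair (.snd (.fst (.snd (.var rfl)))) (.snd (.snd (.snd (.var rfl)))))) (hd 5 _ rfl) h))⟩
    simp only [List.length_cons]
    omega

theorem derivative_steps {l T : ℕ} {S : List (Fin n)} (hT : ∀ v, ∃ t ≤ T,
      Steps defs [.pair (.num l) (.pair (M.row v) (M.records p S))] (Code.ratio o)
        (.num (approxRatio M.Meets p l v S)) t) (q₀ q₁ : Fin n → ℝ) (L : List (Fin n)) :
    ∃ t ≤ L.length * (T + 60) + 10, Steps defs
      [.pair (.ofList (L.map M.row)) (.pair (.pair (.ofList (L.map fun j => .num (q₀ j)))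
        (.ofList (L.map fun j => .num (q₁ j)))) (.pair (.num l) (M.records p S)))]
      (Code.derivative o)
      (.num ((L.map fun j => (q₁ j - q₀ j) * approxRatio M.Meets p l j S).sum)) t := by
  induction L with
  | nil =>
    refine ⟨_, ?_, .ifPair_no (u := .nil) (.fst (.var rfl)) (by simp) (.numCast (by simp) .const)⟩
    simp
  | cons a L ih =>
    obtain ⟨t, ht, h⟩ := ih
    obtain ⟨s, hs, hss⟩ := hT a
    refine ⟨_, ?_, .ifPair_yes (.fst (.var rfl)) (.arith (.arith
      (.arith (.fst (.snd (.fst (.snd (.var rfl))))) (.fst (.fst (.fst (.snd (.var rfl))))))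
      (.call (.pair (.fst (.snd (.snd (.var rfl)))) (.pair (.fst (.fst (.var rfl)))
        (.snd (.snd (.snd (.var rfl)))))) (hd 3 _ rfl) hss))
      (.call (.pair (.snd (.fst (.var rfl))) (.pair (.pair (.snd (.fst (.fst (.snd (.var rfl)))))
        (.snd (.snd (.fst (.snd (.var rfl)))))) (.snd (.snd (.var rfl))))) (hd 6 _ rfl) h))⟩
    rw [List.length_cons, Nat.succ_mul]
    omega

end Recursion

/-! ### The rounding loop -/

section RoundAll

theorem ofFn_update {m k : ℕ} (hk : k < m) (z : Fin m → ℝ) (x : ℝ) :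
    (List.ofFn fun i => Val.num (Function.update z ⟨k, hk⟩ x i)) =
      (List.ofFn fun i => Val.num (z i)).take k ++
        Val.num x :: (List.ofFn fun i => Val.num (z i)).drop (k + 1) := by
  have h : (List.ofFn fun i => Val.num (Function.update z ⟨k, hk⟩ x i)) =
      (List.ofFn fun i => Val.num (z i)).set k (Val.num x) := by
    refine List.ext_getElem (by simp) fun i h1 h2 => ?_
    simp only [List.getElem_ofFn, List.getElem_set, Function.update_apply, Fin.mk.injEq,
      eq_comm (a := k)]
    split_ifs <;> rfl
  rw [h, List.set_eq_take_append_cons_drop, if_pos (by simpa using hk)]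

theorem take_ofFn_update {m k : ℕ} (hk : k < m) (z : Fin m → ℝ) (x : ℝ) :
    (List.ofFn fun i => Val.num (Function.update z ⟨k, hk⟩ x i)).take k =
      (List.ofFn fun i => Val.num (z i)).take k := by
  rw [ofFn_update, List.take_left' (by simp; omega)]

theorem drop_ofFn_update {m k : ℕ} (hk : k < m) (z : Fin m → ℝ) (x : ℝ) :
    (List.ofFn fun i => Val.num (Function.update z ⟨k, hk⟩ x i)).drop k =
      Val.num x :: (List.ofFn fun i => Val.num (z i)).drop (k + 1) := by
  rw [ofFn_update, List.drop_left' (by simp; omega)]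

theorem reverse_take_ofFn {m k : ℕ} (hk : k < m) (z : Fin m → ℝ) :
    ((List.ofFn fun i => Val.num (z i)).take (k + 1)).reverse =
      Val.num (z ⟨k, hk⟩) :: ((List.ofFn fun i => Val.num (z i)).take k).reverse := by
  rw [List.take_succ_eq_append_getElem (by simpa using hk)]
  simp

/-- The state of the loop in which the coordinates from `k` on are rounded. -/
noncomputable def loopState {n m : ℕ} (M : VariableModel n m) (w : Val) (z : Fin m → ℝ)
    (t step : ℝ) (l k : ℕ) : Val :=
  -- The prefix is stored reversed, so the next coordinate to be rounded, with index `k - 1`, is at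
  -- its head.
  .pair (.pair (.ofList ((List.ofFn fun i => Val.num (z i)).take k).reverse)
      (.ofList ((List.ofFn fun i => Val.num (z i)).drop k)))
    (.pair (.num t) (.pair (.num step) (.pair (.num l) (.pair M.encodeVars w))))

theorem loopState_succ {n m : ℕ} (M : VariableModel n m) (w : Val) (z : Fin m → ℝ)
    (t step : ℝ) (l : ℕ) {k : ℕ} (hk : k < m) :
    loopState M w z t step l (k + 1) =
    .pair (.pair (.pair (.num (z ⟨k, hk⟩)) (.ofList ((List.ofFn fun i => Val.num (z i)).take k).reverse))
      (.ofList ((List.ofFn fun i => Val.num (z i)).drop (k + 1))))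
    (.pair (.num t) (.pair (.num step) (.pair (.num l) (.pair M.encodeVars w)))) := by
  rw [loopState, reverse_take_ofFn hk]
  rfl

theorem loopState_update {n m : ℕ} (M : VariableModel n m) (w : Val) (z : Fin m → ℝ)
    (t step : ℝ) (l : ℕ) {k : ℕ} (hk : k < m) (x : ℝ) :
    loopState M w (Function.update z ⟨k, hk⟩ x) t step l k =
    .pair (.pair (.ofList ((List.ofFn fun i => Val.num (z i)).take k).reverse)
      (.pair (.num x) (.ofList ((List.ofFn fun i => Val.num (z i)).drop (k + 1)))))
    (.pair (.num t) (.pair (.num step) (.pair (.num l) (.pair M.encodeVars w)))) := by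
  rw [loopState, take_ofFn_update, drop_ofFn_update]
  rfl

variable {n m : ℕ} (M : VariableModel n m) {defs : List Code} {o : ℕ}
  (hd : HasFunctions defs o) {w : Val} {probCode : Code} {T₀ : ℕ}
  (hprob : defs[o]? = some probCode)
  (hT₀ : ∀ z : Fin m → ℝ, (∀ i, 0 ≤ z i ∧ z i ≤ 1) → ∃ t ≤ T₀, Steps defs
    [.pair (.pair M.encodeVars w) (encodeVec z)] probCode (encodeVec (M.prob z)) t)
include hd hprob hT₀

theorem probAt_steps {z : Fin m → ℝ} (hz : ∀ i, 0 ≤ z i ∧ z i ≤ 1) {t step : ℝ} {l k : ℕ}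
    (hk : k < m) {env : List Val} {i : ℕ}
    (henv : env[i]? = some (loopState M w z t step l (k + 1))) {b : ℚ} {x : ℝ} (hbx : (b : ℝ) = x)
    (hx0 : 0 ≤ x) (hx1 : x ≤ 1) :
    ∃ s ≤ T₀ + 20 * (m + 1) + 40, Steps defs env (Code.probAt o (.var i) b)
      (encodeVec (M.prob (Function.update z ⟨k, hk⟩ x))) s := by
  obtain ⟨s, hs, h⟩ := hT₀ _ (update_mem_unit hz ⟨k, hk⟩ hx0 hx1)
  obtain ⟨r, hr, h'⟩ := revAppend_steps hd
    ((List.ofFn fun i => Val.num (z i)).take k).reverse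
    (Val.num x :: (List.ofFn fun i => Val.num (z i)).drop (k + 1))
  rw [List.reverse_reverse, ← ofFn_update hk] at h'
  rw [loopState_succ (hk := hk)] at henv
  have hlen : ((List.ofFn fun i => Val.num (z i)).take k).reverse.length ≤ m := by
    simp
  refine ⟨_, ?_, .call (.pair (.snd (.snd (.snd (.snd (.var henv))))) (.call (.pair
    (.snd (.fst (.fst (.var henv)))) (.pair (.numCast hbx .const) (.snd (.fst (.var henv)))))
    (hd 0 _ rfl) h')) hprob h⟩
  omega

/-- Induction on the number `k` of unrounded coordinates with invariant `hP`; by `hδstep`, giving up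
one `step` of slack pays for the factor `(1 + δ) ^ 2`. -/
theorem roundAll_steps {step δ θ : ℝ} {l T : ℕ} (hn : 0 < n) (hstep : 0 ≤ step) (hδ : 0 < δ)
    (hδ1 : δ ≤ 1) (hθ1 : θ ≤ 1 / 2) (hθδ : θ ^ 2 ≤ Real.log (1 + δ))
    (hl : 8 * (n : ℝ) ^ 2 * (1 - θ) ^ l < δ ^ 3)
    (hδstep : ∀ k < m, (1 + δ) * (1 + δ) * (1 + step * k) ≤ 1 + step * (k + 1))
    (hT : ∀ (p : Fin n → ℝ) (v : Fin n) (S : List (Fin n)), S.Nodup → ∃ t ≤ T, Steps defs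
      [.pair (.num (l + 1 : ℕ)) (.pair (M.row v) (M.records p S))] (Code.ratio o)
        (.num (approxRatio M.Meets p (l + 1) v S)) t)
    (k : ℕ) (hk : k ≤ m) {z : Fin m → ℝ} (hz : ∀ i, 0 ≤ z i ∧ z i ≤ 1)
    (hround : ∀ i : Fin m, k ≤ i → z i = 0 ∨ z i = 1)
    (hP : Positive M.depGraph ((1 + step * k) • M.prob z)) :
    ∃ ω : Fin m → Bool, (∀ j, ω ∉ M.event j) ∧
      ∃ t ≤ k * (3 * T₀ + 60 * (m + 1) + 40 * (n + 1) + n * (T + 60) + 400) + 10,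
        Steps defs [loopState M w z (1 + step * k) step (l + 1) k] (Code.roundAll o)
          (encodePoint ω) t := by
  induction k generalizing z with
  | zero =>
    refine ⟨fun i => decide (z i = 1), fun j => ?_, ?_⟩
    · have hzω : (fun i => if decide (z i = 1) = true then (1 : ℝ) else 0) = z := by
        funext i
        rcases hround i (Nat.zero_le _) with h | h <;> simp [h]
      refine M.notMem_event ?_
      rw [hzω]
      -- The polynomial of `{j}` is `1 - p_j`, and the slack factor is now 1.
      have := hP.2 {j}
      rw [qBreve_singleton] at this
      simpa using this
    · have hzω : (fun i => if decide (z i = 1) = true then (1 : ℝ) else 0) = z := by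
        funext i
        rcases hround i (Nat.zero_le _) with h | h <;> simp [h]
      rw [encodePoint, hzω]
      refine ⟨_, ?_, .ifPair_no (u := .nil) (.fst (.fst (.var rfl))) (by simp)
        (.snd (.fst (.var rfl)))⟩
      omega
  | succ k ih =>
    have hkm : k < m := hk
    -- The probabilities are evaluated below two local definitions, so the loop state is the
    -- variable 2.
    obtain ⟨t₀, ht₀, h₀⟩ := probAt_steps M hd hprob hT₀ hz (t := 1 + step * (k + 1 : ℕ))
      (step := step) (l := l + 1) hkm (env := [M.records ((1 + step * k) • M.prob z)
        (List.finRange n), .num (1 + step * k),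
        loopState M w z (1 + step * (k + 1 : ℕ)) step (l + 1) (k + 1)]) (i := 2) rfl
      (b := 0) (x := 0) (by simp) le_rfl zero_le_one
    obtain ⟨t₁, ht₁, h₁⟩ := probAt_steps M hd hprob hT₀ hz (t := 1 + step * (k + 1 : ℕ))
      (step := step) (l := l + 1) hkm (env := [M.records ((1 + step * k) • M.prob z)
        (List.finRange n), .num (1 + step * k),
        loopState M w z (1 + step * (k + 1 : ℕ)) step (l + 1) (k + 1)]) (i := 2) rfl
      (b := 1) (x := 1) (by simp) zero_le_one le_rfl
    obtain ⟨tp, htp, hp⟩ := hT₀ z hz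
    obtain ⟨tr, htr, hr⟩ := revAppend_steps hd
      ((List.ofFn fun i => Val.num (z i)).take (k + 1)).reverse
      ((List.ofFn fun i => Val.num (z i)).drop (k + 1))
    rw [List.reverse_reverse, List.take_append_drop] at hr
    have hlen : ((List.ofFn fun i => Val.num (z i)).take (k + 1)).reverse.length ≤ m := by
      simp
    obtain ⟨tj, htj, hj⟩ := join_steps M hd (M.prob z) (1 + step * k) (List.finRange n)
    rw [← M.encodeVars_eq, ← encodeVec_eq] at hj
    obtain ⟨td, htd, hdv⟩ := derivative_steps M hd ((1 + step * k) • M.prob z)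
      (S := List.finRange n) (fun v => hT _ v _ (List.nodup_finRange n))
      (M.prob (Function.update z ⟨k, hkm⟩ 0)) (M.prob (Function.update z ⟨k, hkm⟩ 1))
      (List.finRange n)
    rw [← M.encodeVars_eq, ← encodeVec_eq, ← encodeVec_eq, ← Fin.sum_univ_def] at hdv
    rw [List.length_finRange] at htj htd
    set D := ∑ j, (M.prob (Function.update z ⟨k, hkm⟩ 1) j -
      M.prob (Function.update z ⟨k, hkm⟩ 0) j) *
      approxRatio M.Meets ((1 + step * k) • M.prob z) (l + 1) j (List.finRange n) with hD
    have hskip : 0 ≤ step * k := by positivity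
    have hP' : Positive M.depGraph (((1 + δ) * (1 + δ) * (1 + step * k)) • M.prob z) :=
      hP.of_smul (M.prob_nonneg hz) (by positivity) (by push_cast; exact hδstep k hkm)
    have hnext : ∀ b : Bool, (b = true ↔ D ≤ 0) → Positive M.depGraph ((1 + step * k) •
        M.prob (Function.update z ⟨k, hkm⟩ (if b then 1 else 0))) := fun b hb =>
      M.positive_update hn hz (by positivity) hδ hδ1 hθ1 hθδ hl hP' ⟨k, hkm⟩ (b := b) hb
    have hround' : ∀ x : ℝ, (x = 0 ∨ x = 1) → ∀ i : Fin m, k ≤ i →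
        Function.update z ⟨k, hkm⟩ x i = 0 ∨ Function.update z ⟨k, hkm⟩ x i = 1 := by
      intro x hx i hi
      by_cases h : i = ⟨k, hkm⟩
      · subst h; simpa using hx
      · rw [Function.update_of_ne h]
        refine hround i ?_
        have : (i : ℕ) ≠ k := fun e => h (Fin.ext e)
        omega
    have et : (ArithOp.sub.apply (1 + step * (k + 1 : ℕ)) step) = 1 + step * k := by
      simp only [ArithOp.apply]; push_cast; ring
    rw [Nat.succ_mul]
    by_cases hDle : D ≤ 0
    · obtain ⟨ω, hω, t, ht, h⟩ := ih hkm.le (update_mem_unit hz ⟨k, hkm⟩ zero_le_one le_rfl)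
        (hround' 1 (Or.inr rfl)) (by simpa using hnext true (by simp [hDle]))
      refine ⟨ω, hω, ?_⟩
      rw [loopState_update] at h
      rw [loopState_succ (hk := hkm)] at h₀ h₁ ⊢
      rw [reverse_take_ofFn hkm] at hr
      refine ⟨_, ?_, .ifPair_yes (.fst (.fst (.var rfl))) (.letIn (.numCast et (.arith
        (.fst (.snd (.var rfl))) (.fst (.snd (.snd (.var rfl)))))) (.letIn (.call (.pair (.var rfl)
        (.pair (.fst (.snd (.snd (.snd (.snd (.var rfl)))))) (.call (.pair
          (.snd (.snd (.snd (.snd (.var rfl))))) (.call (.fst (.var rfl)) (hd 0 _ rfl) hr))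
          hprob hp))) (hd 5 _ rfl) hj) (.ifLe_yes (.call (.pair
          (.fst (.snd (.snd (.snd (.snd (.var rfl)))))) (.pair (.pair h₀ h₁)
          (.pair (.fst (.snd (.snd (.snd (.var rfl))))) (.var rfl)))) (hd 6 _ rfl) hdv)
          .const (by simpa using hDle) (.call (.pair (.pair (.snd (.fst (.fst (.var rfl))))
            (.pair (.numCast (by simp) .const) (.snd (.fst (.var rfl))))) (.pair (.var rfl)
            (.snd (.snd (.var rfl))))) (hd 7 _ rfl) h))))⟩
      omega
    · obtain ⟨ω, hω, t, ht, h⟩ := ih hkm.le (update_mem_unit hz ⟨k, hkm⟩ le_rfl zero_le_one)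
        (hround' 0 (Or.inl rfl)) (by simpa using hnext false (by simp [hDle]))
      refine ⟨ω, hω, ?_⟩
      rw [loopState_update] at h
      rw [loopState_succ (hk := hkm)] at h₀ h₁ ⊢
      rw [reverse_take_ofFn hkm] at hr
      refine ⟨_, ?_, .ifPair_yes (.fst (.fst (.var rfl))) (.letIn (.numCast et (.arith
        (.fst (.snd (.var rfl))) (.fst (.snd (.snd (.var rfl)))))) (.letIn (.call (.pair (.var rfl)
        (.pair (.fst (.snd (.snd (.snd (.snd (.var rfl)))))) (.call (.pair
          (.snd (.snd (.snd (.snd (.var rfl))))) (.call (.fst (.var rfl)) (hd 0 _ rfl) hr))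
          hprob hp))) (hd 5 _ rfl) hj) (.ifLe_no (.call (.pair
          (.fst (.snd (.snd (.snd (.snd (.var rfl)))))) (.pair (.pair h₀ h₁)
          (.pair (.fst (.snd (.snd (.snd (.var rfl))))) (.var rfl)))) (hd 6 _ rfl) hdv)
          .const (by simpa using hDle) (.call (.pair (.pair (.snd (.fst (.fst (.var rfl))))
            (.pair (.numCast (by simp) .const) (.snd (.fst (.var rfl))))) (.pair (.var rfl)
            (.snd (.snd (.var rfl))))) (hd 7 _ rfl) h))))⟩
      omega

end RoundAll

/-! ### The parameters -/

/-- As `l ≥ 105 * s * k`, the power is at most `exp (-15 k) ≤ 2 ^ (-15 k)`. The target needs `8 * 6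
^ 3 = 1728 < 2 ^ 11` times `(n m / α) ^ 3 ≤ 2 ^ (3 k)`, and `11 + 3 k ≤ 15 k`. -/
theorem depth_suffices {n m s k l : ℕ} {α : ℝ} (hn : 0 < n) (hm : 0 < m) (hα : 0 < α)
    (hs : 1 ≤ s) (hk : 1 ≤ k) (hk2 : (n : ℝ) * (m / α) ≤ 2 ^ k) (hl : l + 1 = 106 * s * k) :
    8 * (n : ℝ) ^ 2 * (1 - 1 / (7 * s)) ^ l < (α / (6 * m)) ^ 3 := by
  have hn' : (1 : ℝ) ≤ n := by exact_mod_cast hn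
  have hm' : (0 : ℝ) < m := by exact_mod_cast hm
  have hs' : (1 : ℝ) ≤ s := by exact_mod_cast hs
  have hθ : (0 : ℝ) ≤ 1 - 1 / (7 * s) := by
    rw [sub_nonneg, div_le_one (by positivity)]; linarith
  have h1 : (1 - 1 / (7 * s) : ℝ) ^ l ≤ Real.exp (-(15 * k : ℕ)) := by
    refine (pow_le_pow_left₀ hθ (Real.one_sub_le_exp_neg _) l).trans ?_
    rw [← Real.exp_nat_mul, Real.exp_le_exp, mul_neg, neg_le_neg_iff, mul_one_div,
      le_div_iff₀ (by positivity)]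
    have h2 : 105 * s * k ≤ l := by nlinarith [Nat.mul_le_mul hs hk]
    have h3 : ((105 * s * k : ℕ) : ℝ) ≤ l := by exact_mod_cast h2
    push_cast at h3 ⊢
    linarith
  have h2 : (2 : ℝ) ^ (15 * k) ≤ Real.exp (15 * k : ℕ) := by
    have e : Real.exp (15 * k : ℕ) = Real.exp 1 ^ (15 * k) := by
      rw [← Real.exp_nat_mul, mul_one]
    rw [e]
    exact pow_le_pow_left₀ (by norm_num) (by linarith [Real.add_one_le_exp 1]) _
  have h3 : 1728 * ((n : ℝ) * (m / α)) ^ 3 < Real.exp (15 * k : ℕ) := by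
    refine lt_of_lt_of_le ?_ h2
    calc 1728 * ((n : ℝ) * (m / α)) ^ 3 ≤ 1728 * (2 ^ k) ^ 3 := by gcongr
      _ < 2 ^ 11 * (2 ^ k) ^ 3 := by
        have : (0 : ℝ) < (2 ^ k) ^ 3 := by positivity
        nlinarith
      _ = 2 ^ (11 + 3 * k) := by rw [pow_add, ← pow_mul, mul_comm k 3]
      _ ≤ 2 ^ (15 * k) := pow_le_pow_right₀ (by norm_num) (by omega)
  rw [Real.exp_neg] at h1
  have hE := Real.exp_pos (15 * k : ℕ)
  calc 8 * (n : ℝ) ^ 2 * (1 - 1 / (7 * s)) ^ l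
      ≤ 8 * (n : ℝ) ^ 3 * (Real.exp (15 * k : ℕ))⁻¹ := by
        have h4 : (n : ℝ) ^ 2 ≤ n ^ 3 := pow_le_pow_right₀ hn' (by norm_num)
        have h5 := pow_nonneg hθ l
        gcongr
    _ < (α / (6 * m)) ^ 3 := by
        rw [← div_eq_mul_inv, div_lt_iff₀ hE]
        have e : 8 * (n : ℝ) ^ 3 = (α / (6 * m)) ^ 3 * (1728 * ((n : ℝ) * (m / α)) ^ 3) := by
          field_simp
          norm_num
        rw [e]
        exact mul_lt_mul_of_pos_left h3 (by positivity)

/-- By `log (1 + x) ≥ x / (1 + x)`, the right side is at least `α / (6 m + α)`, while the left side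
is at most `α / (49 m)`. -/
theorem sq_le_log {m s : ℕ} {α : ℝ} (hm : 0 < m) (hα : 0 < α) (hα1 : α ≤ 1) (hs : 1 ≤ s)
    (hs2 : m / α ≤ (s : ℝ) ^ 2) : (1 / (7 * s) : ℝ) ^ 2 ≤ Real.log (1 + α / (6 * m)) := by
  have hm' : (1 : ℝ) ≤ m := by exact_mod_cast hm
  have hs' : (1 : ℝ) ≤ s := by exact_mod_cast hs
  have h1 := Real.one_sub_inv_le_log_of_pos (x := 1 + α / (6 * m)) (by positivity)
  refine le_trans ?_ h1
  have e : 1 - (1 + α / (6 * m))⁻¹ = α / (6 * m + α) := by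
    have : (6 * m + α : ℝ) ≠ 0 := by positivity
    field_simp
    ring
  rw [e, div_pow, one_pow, div_le_div_iff₀ (by positivity) (by positivity)]
  rw [div_le_iff₀ hα] at hs2
  nlinarith

/-- With `α / m = 6 δ`, the loss is `(2 δ + δ ^ 2) * (1 + 6 δ k) ≤ 3 δ * 2`, which explains the 6.
-/
theorem slack_step {m k : ℕ} {α : ℝ} (hk : k < m) (hα : 0 < α) (hα1 : α ≤ 1) :
    (1 + α / (6 * m)) * (1 + α / (6 * m)) * (1 + α / m * k) ≤ 1 + α / m * (k + 1) := by
  have hm : (0 : ℝ) < m := by exact_mod_cast (Nat.zero_le k).trans_lt hk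
  have hkm : (k : ℝ) ≤ m := by exact_mod_cast hk.le
  have hm1 : (1 : ℝ) ≤ m := by exact_mod_cast (Nat.zero_le k).trans_lt hk
  have e : α / m = 6 * (α / (6 * m)) := by field_simp
  set δ := α / (6 * m) with hδ
  have hδ0 : 0 < δ := by positivity
  have hδm : 6 * δ * m = α := by rw [hδ]; field_simp
  rw [e]
  have h1 : 6 * δ * k ≤ 1 := by nlinarith
  have h2 : 6 * δ ≤ 1 := by nlinarith
  nlinarith [mul_nonneg hδ0.le (sub_nonneg.2 h1), mul_nonneg (sq_nonneg δ) (sub_nonneg.2 h1),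
    mul_nonneg hδ0.le (sub_nonneg.2 h2)]

/-- Every term is bounded by a multiple of `U ^ (c + 4) * E` with `U = n + m + 1`, or of `N`; the
coefficients add up to less than `2048 = 2 ^ 11`. -/
theorem steps_poly_le {n m s k N E : ℝ} {c : ℕ} (hN1 : 1 ≤ N) (hm : 1 ≤ m) (hn : 1 ≤ n)
    (hUN : n + m + 1 ≤ N ^ 3) (hE1 : 1 ≤ E) (hs : s ≤ 3 * N) (hk : k ≤ 6 * N) :
    m * (3 * (n + m + 1) ^ c + 60 * (m + 1) + 40 * (n + 1) +
      n * (150 * (m + 1) * (n + 1) * E + 60) + 400) + 30 * (n + m + s + k) + 300 ≤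
      2048 * (N ^ (3 * c + 12) * E) := by
  obtain ⟨U, hU⟩ : ∃ U, U = n + m + 1 := ⟨_, rfl⟩
  rw [← hU] at hUN ⊢
  have hU1 : 1 ≤ U := by linarith
  have hmU : m ≤ U := by linarith
  have hnU : n ≤ U := by linarith
  have hm1U : m + 1 ≤ U := by linarith
  have hn1U : n + 1 ≤ U := by linarith
  have hUc : ∀ a b : ℕ, a ≤ b → U ^ a ≤ U ^ b * E := fun a b hab =>
    (pow_le_pow_right₀ hU1 hab).trans (le_mul_of_one_le_right (by positivity) hE1)
  have hE4 : U ^ 4 * E ≤ U ^ (c + 4) * E :=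
    mul_le_mul_of_nonneg_right (pow_le_pow_right₀ hU1 (by omega)) (by linarith)
  have hXN : U ^ (c + 4) * E ≤ N ^ (3 * c + 12) * E := by
    have : U ^ (c + 4) ≤ (N ^ 3) ^ (c + 4) := pow_le_pow_left₀ (by linarith) hUN _
    rw [← pow_mul, show 3 * (c + 4) = 3 * c + 12 by ring] at this
    exact mul_le_mul_of_nonneg_right this (by linarith)
  have hNX : N ≤ N ^ (3 * c + 12) * E :=
    (le_self_pow₀ hN1 (by omega)).trans (le_mul_of_one_le_right (by positivity) hE1)
  have hc1 := hUc (c + 1) (c + 4) (by omega)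
  have h2 := hUc 2 (c + 4) (by omega)
  have h1 := hUc 1 (c + 4) (by omega)
  have h0 := hUc 0 (c + 4) (by omega)
  rw [pow_one] at h1
  rw [pow_zero] at h0
  generalize U ^ (c + 4) * E = X at *
  generalize N ^ (3 * c + 12) * E = Y at *
  have a1 : m * (3 * U ^ c) ≤ 3 * X := by
    calc m * (3 * U ^ c) ≤ U * (3 * U ^ c) := by gcongr
      _ = 3 * U ^ (c + 1) := by ring
      _ ≤ 3 * X := by linarith
  have a2 : m * (60 * (m + 1) + 40 * (n + 1)) ≤ 100 * X := by
    calc m * (60 * (m + 1) + 40 * (n + 1)) ≤ U * (60 * U + 40 * U) := by gcongr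
      _ = 100 * U ^ 2 := by ring
      _ ≤ 100 * X := by linarith
  have a3 : m * (n * (150 * (m + 1) * (n + 1) * E)) ≤ 150 * X := by
    calc m * (n * (150 * (m + 1) * (n + 1) * E)) ≤ U * (U * (150 * U * U * E)) := by gcongr
      _ = 150 * (U ^ 4 * E) := by ring
      _ ≤ 150 * X := by linarith
  have a4 : m * (n * 60 + 400) ≤ 460 * X := by
    calc m * (n * 60 + 400) ≤ U * (U * 60 + 400) := by gcongr
      _ = 60 * U ^ 2 + 400 * U := by ring
      _ ≤ 460 * X := by linarith
  linarith

/-- The number of steps is within the bound. -/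
theorem steps_le {n m d s k l c t : ℕ} {α : ℝ} (hn : 0 < n) (hm : 0 < m) (hα : 0 < α)
    (hα1 : α ≤ 1) (hs : (s : ℝ) ≤ Real.sqrt (m / α) + 2)
    (hk : (k : ℝ) ≤ Real.logb 2 (max 2 (n * m / α)) + 2) (hl : l ≤ 106 * s * k)
    (ht : t ≤ m * (3 * (n + m + 1) ^ c + 60 * (m + 1) + 40 * (n + 1) +
      n * (150 * (m + 1) * (n + 1) * (d + 2) ^ l + 60) + 400) +
      30 * (n + m + s + k) + 300) :
    (t : ℝ) ≤ max 2 ((n : ℝ) * m / α) ^ ((3 * c + 2000) / Real.log 2 *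
      Real.log (max 2 (d : ℝ)) * Real.sqrt (m / α)) := by
  have hn' : (1 : ℝ) ≤ n := by exact_mod_cast hn
  have hm' : (1 : ℝ) ≤ m := by exact_mod_cast hm
  set N : ℝ := max 2 ((n : ℝ) * m / α) with hN
  set D : ℝ := max 2 (d : ℝ) with hD
  set S : ℝ := Real.sqrt (m / α) with hS
  have hN2 : 2 ≤ N := le_max_left _ _
  have hD2 : 2 ≤ D := le_max_left _ _
  have hmα : (m : ℝ) ≤ m / α := by rw [le_div_iff₀ hα]; nlinarith
  have hS1 : 1 ≤ S := Real.one_le_sqrt.2 (hm'.trans hmα)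
  have hSN : S ≤ N := by
    have h1 : S ^ 2 = m / α := Real.sq_sqrt (by positivity)
    have h2 : (m : ℝ) / α ≤ n * m / α := by
      rw [mul_div_assoc]; exact le_mul_of_one_le_left (by positivity) hn'
    have h3 : (n : ℝ) * m / α ≤ N := le_max_right _ _
    nlinarith
  have hnmN : (n : ℝ) * m ≤ N := by
    refine le_trans ?_ (le_max_right _ _)
    rw [le_div_iff₀ hα]
    exact mul_le_of_le_one_right (by positivity) hα1
  have hlog2 : 0 < Real.log 2 := Real.log_pos (by norm_num)
  have hlogN : Real.log 2 ≤ Real.log N := Real.log_le_log (by norm_num) hN2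
  have hlogD : Real.log 2 ≤ Real.log D := Real.log_le_log (by norm_num) hD2
  have hlogb1 : 1 ≤ Real.logb 2 N := by
    rw [Real.logb, le_div_iff₀ hlog2]; linarith
  have hs3 : (s : ℝ) ≤ 3 * S := by linarith
  have hk3 : (k : ℝ) ≤ 3 * Real.logb 2 N := by linarith
  have hlogbN : Real.logb 2 N ≤ 2 * N := by
    rw [Real.logb, div_le_iff₀ hlog2]
    have h1 := Real.log_le_sub_one_of_pos (x := N) (by linarith)
    have h2 : (1 / 2 : ℝ) ≤ Real.log 2 := by linarith [Real.log_two_gt_d9]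
    nlinarith
  set U : ℝ := (n : ℝ) + m + 1 with hU
  have hUN : U ≤ N ^ 3 := by nlinarith [mul_nonneg (sub_nonneg.2 hn') (sub_nonneg.2 hm'), sq_nonneg N]
  set E : ℝ := ((d : ℝ) + 2) ^ l with hE
  have hd0 : (0 : ℝ) ≤ d := Nat.cast_nonneg d
  have hE1 : 1 ≤ E := one_le_pow₀ (by linarith)
  have hdD : (d : ℝ) + 2 ≤ D ^ 2 := by
    have : (d : ℝ) ≤ D := le_max_right _ _
    nlinarith
  -- `954 = 106 * 3 * 3`.
  have hlS : (l : ℝ) ≤ 954 * S * Real.logb 2 N := by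
    have hl' : (l : ℝ) ≤ 106 * s * k := by exact_mod_cast hl
    have := mul_le_mul hs3 hk3 (Nat.cast_nonneg k) (by positivity)
    nlinarith
  have hEN : E ≤ N ^ (1908 / Real.log 2 * Real.log D * S) := by
    have h1 : E ≤ (D ^ 2) ^ l := pow_le_pow_left₀ (by positivity) hdD l
    refine h1.trans ?_
    -- Exchange of base and exponent: a power of `D` with exponent proportional to `log N` is a
    -- power of `N` with exponent proportional to `log D`.
    rw [← pow_mul, ← Real.rpow_natCast, Real.rpow_def_of_pos (by linarith),
      Real.rpow_def_of_pos (by linarith), Real.exp_le_exp]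
    push_cast
    have h2 : Real.log D * (2 * l) ≤ Real.log D * (2 * (954 * S * Real.logb 2 N)) := by
      have : 0 ≤ Real.log D := by linarith
      gcongr
    refine h2.trans (le_of_eq ?_)
    rw [Real.logb]
    field_simp
    ring
  have hU1 : 1 ≤ U := by linarith
  have htU : (t : ℝ) ≤ 2048 * (N ^ (3 * c + 12) * E) := by
    have ht' : (t : ℝ) ≤ m * (3 * U ^ c + 60 * (m + 1) + 40 * (n + 1) +
        n * (150 * (m + 1) * (n + 1) * E + 60) + 400) + 30 * (n + m + s + k) + 300 := by
      have h1 : (t : ℝ) ≤ _ := Nat.cast_le.2 ht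
      push_cast at h1
      exact h1
    exact ht'.trans (steps_poly_le (by linarith) hm' hn' hUN hE1 (by linarith) (by linarith))
  -- The polynomial factor fits as well, because `log D / log 2` and `S` are at least 1; `23 = 11 +
  -- 12`.
  have hpoly : (2048 : ℝ) * N ^ (3 * c + 12) ≤
      N ^ ((3 * c + 23) / Real.log 2 * Real.log D * S) := by
    have h1 : (2048 : ℝ) ≤ N ^ 11 := by
      calc (2048 : ℝ) = 2 ^ 11 := by norm_num
        _ ≤ N ^ 11 := pow_le_pow_left₀ (by norm_num) hN2 _
    calc (2048 : ℝ) * N ^ (3 * c + 12) ≤ N ^ 11 * N ^ (3 * c + 12) := by gcongr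
      _ = N ^ ((3 * c + 23 : ℕ) : ℝ) := by
          rw [Real.rpow_natCast, ← pow_add]; congr 1; ring
      _ ≤ _ := by
          refine Real.rpow_le_rpow_of_exponent_le (by linarith) ?_
          push_cast
          rw [div_mul_eq_mul_div, div_mul_eq_mul_div, le_div_iff₀ hlog2, mul_assoc]
          gcongr
          nlinarith
  calc (t : ℝ) ≤ 2048 * N ^ (3 * c + 12) * E := by rw [mul_assoc]; exact htU
    _ ≤ N ^ ((3 * c + 23) / Real.log 2 * Real.log D * S) *
        N ^ (1908 / Real.log 2 * Real.log D * S) := mul_le_mul hpoly hEN (by linarith)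
          (by positivity)
    _ = N ^ ((3 * c + 1931) / Real.log 2 * Real.log D * S) := by
        rw [← Real.rpow_add (by linarith)]
        congr 1
        ring
    _ ≤ _ := by
        refine Real.rpow_le_rpow_of_exponent_le (by linarith) ?_
        have : 0 ≤ Real.log D := by linarith
        gcongr
        norm_num

end LLL

/-! ### Assembly of the theorem -/

open LLL in
theorem mainTheorem5 (c : ℕ) :
    ∃ C : ℝ, 0 < C ∧
      ∀ (D : LLL.DescriptionFormat) (Q : LLL.Program), LLL.ComputesProb D Q c →
        ∃ P : LLL.Program,
          ∀ (n m : ℕ), 0 < n → 0 < m →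
          ∀ (M : LLL.VariableModel n m) (w : LLL.Val), D n m M w →
          ∀ (z : Fin m → ℝ) (α : ℝ), (∀ i, 0 ≤ z i ∧ z i ≤ 1) → 0 < α → α ≤ 1 →
            (1 + α) • M.prob z ∈ LLL.shearerRegion M.depGraph →
            ∃ (ω : Fin m → Bool) (t : ℕ),
              P.Runs (.pair (.pair M.encodeVars w) (.pair (LLL.encodeVec z) (.num α)))
                (LLL.encodePoint ω) t ∧
              (t : ℝ) ≤ max 2 ((n : ℝ) * (m : ℝ) / α) ^
                (C * Real.log (max 2 (M.maxDegree : ℝ)) * Real.sqrt ((m : ℝ) / α)) ∧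
              ∀ j, ω ∉ M.event j := by
  refine ⟨(3 * c + 2000) / Real.log 2, div_pos (by positivity) (Real.log_pos (by norm_num)),
    fun D Q hQ => ⟨roundingProgram Q, ?_⟩⟩
  intro n m hn hm M w hw z α hz hα hα1 hmem
  have hm0 : (0 : ℝ) < m := by exact_mod_cast hm
  have hm1 : (1 : ℝ) ≤ m := by exact_mod_cast hm
  have hd := roundingProgram_hasFunctions Q
  have hprob : (roundingProgram Q).defs[Q.defs.length]? = some Q.main := by
    simp [roundingProgram]
  have hT₀ : ∀ z : Fin m → ℝ, (∀ i, 0 ≤ z i ∧ z i ≤ 1) → ∃ t ≤ (n + m + 1) ^ c,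
      Steps (roundingProgram Q).defs [.pair (.pair M.encodeVars w) (encodeVec z)] Q.main
        (encodeVec (M.prob z)) t := by
    intro z hz
    obtain ⟨t, h, ht⟩ := hQ n m M w hw z hz
    refine ⟨t, ht, Steps.mono (fun f b hf => ?_) h⟩
    rw [roundingProgram, List.getElem?_append_left (List.getElem?_eq_some_iff.1 hf).1]
    exact hf
  set defs := (roundingProgram Q).defs
  set o := Q.defs.length
  obtain ⟨s, hs, hs2, hs1, ts, hts, hss⟩ := sqrtSearch_steps hd (T := m / α) (s := 1)
    ⌈Real.sqrt (m / α)⌉₊ (by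
      have h1 := Nat.le_ceil (Real.sqrt (m / α))
      have h2 := Real.sq_sqrt (show (0 : ℝ) ≤ m / α by positivity)
      have h3 := Real.sqrt_nonneg (m / α)
      push_cast
      nlinarith)
  obtain ⟨k, hk, hk2, hk1, tk, htk, hks⟩ := logSearch_steps hd (T := n * (m / α)) (s := 1)
    ⌈Real.logb 2 (max 2 (n * m / α))⌉₊ (by
      have h1 := Nat.le_ceil (Real.logb 2 (max 2 (n * m / α)))
      have h0 : (0 : ℝ) < max 2 (n * m / α) := lt_max_of_lt_left (by norm_num)
      rw [← mul_div_assoc]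
      refine (le_max_right 2 _).trans ?_
      rw [Real.logb_le_iff_le_rpow (by norm_num) h0, Real.rpow_natCast] at h1
      exact h1.trans (pow_le_pow_right₀ (by norm_num) (by omega)))
  -- The program runs at depth `l + 1`: the outermost level only multiplies, and the remaining `l`
  -- levels contract the error.
  obtain ⟨l, hl⟩ : ∃ l, l + 1 = 106 * s * k :=
    ⟨106 * s * k - 1, Nat.sub_add_cancel (by nlinarith [Nat.mul_le_mul hs1 hk1])⟩
  have hs1' : (1 : ℝ) ≤ s := by exact_mod_cast hs1
  obtain ⟨ω, hω, t, ht, hrun⟩ := roundAll_steps M hd hprob hT₀ (step := α / m)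
    (δ := α / (6 * m)) (θ := 1 / (7 * s)) (l := l) hn (by positivity) (by positivity)
    (by rw [div_le_one (by positivity)]; linarith)
    (by rw [div_le_div_iff₀ (by positivity) (by norm_num)]; linarith)
    (sq_le_log hm hα hα1 hs1 hs2) (depth_suffices hn hm hα hs1 hk1 hk2 hl)
    (fun k hk => slack_step hk hα hα1)
    (fun p v S hS => ratio_steps M hd p (l + 1) v S hS) m le_rfl hz
    (fun i hi => absurd i.2 (not_lt.2 hi))
    (by
      rw [div_mul_cancel₀ _ hm0.ne']
      exact Positive.of_mem_shearerRegion hmem)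
  obtain ⟨tn, htn, hns⟩ := length_steps hd ((List.finRange n).map M.row)
  obtain ⟨tm, htm, hms⟩ := length_steps hd (List.ofFn fun i => Val.num (z i))
  obtain ⟨tr, htr, hrs⟩ := revAppend_steps hd (List.ofFn fun i => Val.num (z i)) []
  rw [← M.encodeVars_eq, List.length_map, List.length_finRange] at hns
  rw [List.length_map, List.length_finRange] at htn
  rw [List.length_ofFn] at htm hms htr
  rw [List.append_nil] at hrs
  rw [loopState, div_mul_cancel₀ _ hm0.ne', List.take_of_length_le (by simp),
    List.drop_of_length_le (by simp), hl] at hrun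
  -- The searches may stop early, so their cost is bounded through the ceilings instead of `s` and
  -- `k`.
  have hmain : ∃ t' ≤ m * (3 * (n + m + 1) ^ c + 60 * (m + 1) + 40 * (n + 1) +
      n * (150 * (m + 1) * (n + 1) * (M.maxDegree + 2) ^ (l + 1) + 60) + 400) +
      30 * (n + m + (⌈Real.sqrt (m / α)⌉₊ + 1) + (⌈Real.logb 2 (max 2 (n * m / α))⌉₊ + 1)) + 300,
      (roundingProgram Q).Runs (.pair (.pair M.encodeVars w) (.pair (encodeVec z) (.num α)))
        (encodePoint ω) t' := by
    refine ⟨_, ?_, .letIn (.call (.fst (.fst (.var rfl))) (hd 8 _ rfl) hns) (.letIn (.call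
      (.fst (.snd (.var rfl))) (hd 8 _ rfl) hms) (.letIn (.arith (.var rfl) (.snd (.snd (.var rfl))))
      (.letIn (.numCast (y := (106 * s * k : ℕ)) ?_ (.arith (.arith .const (.call (.pair (.var rfl)
        (.numCast (by simp) .const)) (hd 9 _ rfl) hss)) (.call (.pair (.arith (.var rfl) (.var rfl))
        (.pair (.numCast (by simp) .const) (.numCast (by simp) .const))) (hd 10 _ rfl) hks)))
      (.call (.pair (.pair (.call (.pair (.fst (.snd (.var rfl))) .nil) (hd 0 _ rfl) hrs) .nil)
        (.pair (.numCast (x := ((1 : ℚ) : ℝ) + α) (by simp) (.arith .const (.snd (.snd (.var rfl)))))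
        (.pair (.arith (.snd (.snd (.var rfl))) (.var rfl)) (.pair (.var rfl) (.fst (.var rfl))))))
        (hd 7 _ rfl) hrun))))⟩
    · omega
    · simp [ArithOp.apply]
  obtain ⟨t', ht', hrun'⟩ := hmain
  refine ⟨ω, t', hrun', ?_, hω⟩
  have hc1 := Nat.ceil_lt_add_one (Real.sqrt_nonneg (m / α))
  have hc2 := Nat.ceil_lt_add_one (Real.logb_nonneg (b := 2) (x := max 2 (n * m / α))
    (by norm_num) ((by norm_num : (1 : ℝ) ≤ 2).trans (le_max_left _ _)))
  refine steps_le (s := ⌈Real.sqrt (m / α)⌉₊ + 1) (l := l + 1)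
    (k := ⌈Real.logb 2 (max 2 (n * m / α))⌉₊ + 1) hn hm hα hα1 ?_ ?_ ?_ ht'
  · push_cast
    linarith
  · push_cast
    linarith
  · rw [hl]
    exact Nat.mul_le_mul (Nat.mul_le_mul_left _ (by omega)) (by omega)
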